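/- Let $\hat e_1=(1,0)$, $\hat e_2=\frac12(1,\sqrt3)$, $\hat e_3=\frac12(-1,\sqrt3)$, let $\mathcal L=\mathbb Z\hat e_1+\mathbb Z\hat e_2$ be the triangular lattice, with the sublattices $\mathcal L^1=\mathbb Z(\hat e_1+\hat e_2)+\mathbb Z(\hat e_2+\hat e_3)$, $\mathcal L^2=\mathcal L^1+\hat e_1$, $\mathcal L^3=\mathcal L^1+\hat e_2$. For $\varepsilon>0$ put $\mathcal L_\varepsilon=\varepsilon\mathcal L$, $\mathcal L^\alpha_\varepsilon=\varepsilon\mathcal L^\alpha$, and let $\mathcal T_\varepsilon$ be the set of closed triangles $T=\mathrm{conv}\{\varepsilon i,\varepsilon j,\varepsilon k\}$ with $i\in\mathcal L^1$, $j\in\mathcal L^2$, $k\in\mathcal L^3$ at mutual distance $1$. For a spin field $u\colon\mathcal L_\varepsilon\to\mathbb S^1$ and $A\subset\mathbb R^2$ set $$F_\varepsilon(u,A)=\sum_{T\in\mathcal T_\varepsilon,\,T\subset A}\varepsilon\,|u(\varepsilon i)+u(\varepsilon j)+u(\varepsilon k)|^2 ,$$ and let the chirality $\chi(u)$ be the function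 that on the interior of each $T\in\mathcal T_\varepsilon$ equals $\frac{2}{3\sqrt3}\big(u(\varepsilon i)\times u(\varepsilon j)+u(\varepsilon j)\times u(\varepsilon k)+u(\varepsilon k)\times u(\varepsilon i)\big)$, where $v\times w=v_1w_2-v_2w_1$. For $\nu\in\mathbb S^1$ let $\nu^\perp=(-\nu_2,\nu_1)$, $R^\nu_{\ell,h}=\{x\in\mathbb R^2: |\langle x,\nu^\perp\rangle|<\ell/2,\ |\langle x,\nu\rangle|<h/2\}$, $Q^\nu=R^\nu_{1,1}$, and $\chi_\nu(x)=1$ if $\langle x,\nu\rangle\ge0$, $\chi_\nu(x)=-1$ otherwise. For $\ell,h>0$ define $$\psi(\ell,h,\nu)=\frac1\ell\inf\Big\{\liminf_{n\to\infty}F_{\varepsilon_n}(u_n,R^\nu_{\ell,h})\Big\}\in[0,+\infty],$$ where the infimum is over all sequences $\varepsilon_n\to0$, $\varepsilon_n>0$, and all spin fields $u_n\colon\mathcal L_{\varepsilon_n}\to\mathbb S^1$ with $\chi(u_n)\to\chi_\nu$ in $L^1(R^\nu_{\ell,h})$. Let $u^{\rm pos}_\varepsilon$ be the spin field equal to $1$,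 $e^{2\pi \mathrm i/3}$, $e^{4\pi \mathrm i/3}$ on $\mathcal L^1_\varepsilon$, $\mathcal L^2_\varepsilon$, $\mathcal L^3_\varepsilon$ respectively, and $u^{\rm neg}_\varepsilon$ the one equal to $1$, $e^{4\pi \mathrm i/3}$, $e^{2\pi \mathrm i/3}$ there. Put $\partial^\pm_\varepsilon Q^\nu=\{x\in\mathcal L_\varepsilon:\pm\langle\nu,x\rangle\ge3\varepsilon,\ \mathrm{dist}(x,\partial Q^\nu)\le3\varepsilon\}$ and $$m_\varepsilon(\nu)=\inf\{F_\varepsilon(u,Q^\nu): u\colon\mathcal L_\varepsilon\to\mathbb S^1,\ u=u^{\rm pos}_\varepsilon\text{ on }\partial^+_\varepsilon Q^\nu,\ u=u^{\rm neg}_\varepsilon\text{ on }\partial^-_\varepsilon Q^\nu\}.$$ Then for every $\nu\in\mathbb S^1$ the limit $\varphi(\nu)=\lim_{\varepsilon\to0^+}m_\varepsilon(\nu)$ exists and is finite, and $$\psi(1,1,\nu)\ \ge\ \varphi(\nu).$$ -/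

import Mathlib

open Filter Topology MeasureTheory
open scoped ENNReal Pointwise

noncomputable section

namespace AFXY

/-- The Euclidean plane. -/
abbrev Plane : Type := EuclideanSpace ℝ (Fin 2)

/-- Counterclockwise rotation by `π / 2`. -/
def perp (ν : Plane) : Plane := !₂[-ν 1, ν 0]

/-- The open rectangle of length `ℓ` and height `h`, centred at the origin, with two sides
orthogonal to `ν`. -/
def rect (ℓ h : ℝ) (ν : Plane) : Set Plane :=
  {x | |inner ℝ x (perp ν)| < ℓ / 2 ∧ |inner ℝ x ν| < h / 2}

/-- The open unit square with one side orthogonal to `ν`. -/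
def square (ν : Plane) : Set Plane := rect 1 1 ν

/-! ### The triangular lattice -/

def e₁ : Plane := !₂[1, 0]

def e₂ : Plane := !₂[1 / 2, √3 / 2]

def e₃ : Plane := !₂[-1 / 2, √3 / 2]

/-- The triangular lattice. -/
def lattice : Set Plane := {x | ∃ z₁ z₂ : ℤ, x = (z₁ : ℝ) • e₁ + (z₂ : ℝ) • e₂}

/-- The translation vectors of the three sublattices. -/
def offset : Fin 3 → Plane := ![0, e₁, e₂]

/-- The three sublattices; the indices `0, 1, 2` stand for the superscripts `1, 2, 3`. -/
def sublattice (α : Fin 3) : Set Plane :=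
  {x | ∃ z₁ z₂ : ℤ, x = (z₁ : ℝ) • (e₁ + e₂) + (z₂ : ℝ) • (e₂ + e₃) + offset α}

theorem e₃_eq : e₃ = e₂ - e₁ := by
  ext i
  fin_cases i <;> simp [e₁, e₂, e₃]
  norm_num

theorem sublattice_subset (α : Fin 3) : sublattice α ⊆ lattice := by
  rintro x ⟨z₁, z₂, rfl⟩
  fin_cases α
  · refine ⟨z₁ - z₂, z₁ + 2 * z₂, ?_⟩
    simp [offset, e₃_eq]
    module
  · refine ⟨z₁ - z₂ + 1, z₁ + 2 * z₂, ?_⟩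
    simp [offset, e₃_eq]
    module
  · refine ⟨z₁ - z₂, z₁ + 2 * z₂ + 1, ?_⟩
    simp [offset, e₃_eq]
    module

/-- A unit triangle of the lattice, given by its vertices. Each such triangle has exactly one vertex
in each of the three sublattices, and the vertices are labelled accordingly. -/
structure Triangle where
  vertex : Fin 3 → Plane
  mem : ∀ α, vertex α ∈ sublattice α
  dist_eq : ∀ α β, α ≠ β → dist (vertex α) (vertex β) = 1

/-- The closed triangle with the vertices `ε i, ε j, ε k`. -/
def Triangle.hull (T : Triangle) (ε : ℝ) : Set Plane :=
  convexHull ℝ (Set.range fun α => ε • T.vertex α)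

/-! ### Spin fields, energy and chirality -/

/-- Spin fields on the scaled lattice; `Circle` is the unit circle of `ℂ`. -/
abbrev SpinField (ε : ℝ) : Type := (ε • lattice : Set Plane) → Circle

/-- The value of a spin field at a vertex of a scaled triangle. -/
def SpinField.at {ε : ℝ} (u : SpinField ε) (T : Triangle) (α : Fin 3) : ℂ :=
  u ⟨ε • T.vertex α, Set.smul_mem_smul_set (sublattice_subset α (T.mem α))⟩

/-- The energy of a spin field in one triangle. -/
def triangleEnergy {ε : ℝ} (u : SpinField ε) (T : Triangle) : ℝ :=
  ε * ‖SpinField.at u T 0 + SpinField.at u T 1 + SpinField.at u T 2‖ ^ 2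

/-- The energy in `A`: the sum over all scaled triangles contained in `A`. -/
def energy {ε : ℝ} (u : SpinField ε) (A : Set Plane) : ℝ≥0∞ :=
  ∑' T : {T : Triangle // T.hull ε ⊆ A}, ENNReal.ofReal (triangleEnergy u T.1)

/-- The cross product of plane vectors, written as complex numbers. -/
def cross (v w : ℂ) : ℝ := v.re * w.im - v.im * w.re

/-- The chirality of a spin field in one triangle. -/
def triangleChirality {ε : ℝ} (u : SpinField ε) (T : Triangle) : ℝ :=
  2 / (3 * √3) *
    (cross (SpinField.at u T 0) (SpinField.at u T 1)
      + cross (SpinField.at u T 1) (SpinField.at u T 2)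
      + cross (SpinField.at u T 2) (SpinField.at u T 0))

open Classical in
/-- The chirality of a spin field as a function on the plane: on the interior of each scaled triangle
(these are pairwise disjoint) it is the chirality in that triangle. The remaining points form a null
set, where the value is `0`. -/
def chirality {ε : ℝ} (u : SpinField ε) (x : Plane) : ℝ :=
  if h : ∃ T : Triangle, x ∈ interior (T.hull ε) then triangleChirality u h.choose else 0

open Classical in
/-- The pure jump function across the line orthogonal to `ν`. -/
def jump (ν : Plane) (x : Plane) : ℝ := if 0 ≤ inner ℝ x ν then 1 else -1

/-! ### The cell formula -/

open Classical in
/-- The ground state of chirality `+1`. -/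
def upos (ε : ℝ) : SpinField ε := fun x =>
  if (x : Plane) ∈ ε • sublattice 0 then Circle.exp 0
  else if (x : Plane) ∈ ε • sublattice 1 then Circle.exp (2 * Real.pi / 3)
  else Circle.exp (4 * Real.pi / 3)

open Classical in
/-- The ground state of chirality `-1`. -/
def uneg (ε : ℝ) : SpinField ε := fun x =>
  if (x : Plane) ∈ ε • sublattice 0 then Circle.exp 0
  else if (x : Plane) ∈ ε • sublattice 1 then Circle.exp (4 * Real.pi / 3)
  else Circle.exp (2 * Real.pi / 3)

/-- The upper discrete boundary of the unit square. -/
def bdryPos (ε : ℝ) (ν : Plane) : Set Plane :=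
  {x | x ∈ ε • lattice ∧ 3 * ε ≤ inner ℝ ν x ∧ Metric.infDist x (frontier (square ν)) ≤ 3 * ε}

/-- The lower discrete boundary of the unit square. -/
def bdryNeg (ε : ℝ) (ν : Plane) : Set Plane :=
  {x | x ∈ ε • lattice ∧ 3 * ε ≤ -inner ℝ ν x ∧ Metric.infDist x (frontier (square ν)) ≤ 3 * ε}

/-- The spin fields that attain the boundary data. -/
def admissible (ε : ℝ) (ν : Plane) : Set (SpinField ε) :=
  {u | (∀ x : (ε • lattice : Set Plane), (x : Plane) ∈ bdryPos ε ν → u x = upos ε x) ∧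
    (∀ x : (ε • lattice : Set Plane), (x : Plane) ∈ bdryNeg ε ν → u x = uneg ε x)}

/-- The least energy in the unit square under the boundary data. -/
def cellMin (ε : ℝ) (ν : Plane) : ℝ≥0∞ := ⨅ u ∈ admissible ε ν, energy u (square ν)

/-- The surface density: the limit of the cell minima as `ε → 0⁺`. -/
def phi (ν : Plane) : ℝ≥0∞ := limUnder (𝓝[>] (0 : ℝ)) fun ε => cellMin ε ν

/-! ### The density obtained by blow-up -/

/-- `ψ(ℓ, h, ν)`: the infimum of the lower limits of the energies in the rectangle, divided by its
length, over all sequences `εₙ → 0⁺` and all spin fields `uₙ` on the `εₙ`-lattice whose chiralities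
converge to the pure jump in `L¹` of the rectangle. -/
def psi (ℓ h : ℝ) (ν : Plane) : ℝ≥0∞ :=
  (ENNReal.ofReal ℓ)⁻¹ *
    sInf {E : ℝ≥0∞ | ∃ (ε : ℕ → ℝ) (u : ∀ n, SpinField (ε n)),
      (∀ n, 0 < ε n) ∧ Tendsto ε atTop (𝓝 0) ∧
      Tendsto (fun n => eLpNorm (fun x => chirality (u n) x - jump ν x) 1
        (volume.restrict (rect ℓ h ν))) atTop (𝓝 0) ∧
      E = liminf (fun n => energy (u n) (rect ℓ h ν)) atTop}

end AFXY

end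

/-!
Upper bound and existence of the limit: place rescaled copies of a field that nearly attains
`m_δ(ν)` side by side along the interface and put the two ground states everywhere else. For `ε`
much smaller than `δ` this gives `m_ε(ν) ≤ m_δ(ν) + O(δ)`, so that the upper limit of the cell
minima is at most their lower limit, and finite.

Lower bound: relative to the ground states of the two half planes, a field is a phase in `𝕊¹` that
is nearly constant wherever the energy is small and the chirality is right. In a boundary layer of
the square the phase is damped to `1`, which produces a field with the boundary data. Damping
multiplies an angle in an interval of length `2π`, so it is costly near the cut of the angle; a good
cut exists by averaging over its position, and a good layer by the pigeonhole principle. The total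
error is controlled by the energy, by the `L¹` distance of the chiralities, and by the layer width,
which is chosen last.
-/

noncomputable section

namespace AFXY

/-! ### Coordinates along and across the interface -/

/-- The coordinate along the interface, the line orthogonal to `ν`. -/
def along (ν : Plane) : Plane →L[ℝ] ℝ := innerSL ℝ (perp ν)

/-- The signed distance from the interface, for a unit vector `ν`. -/
def height (ν : Plane) : Plane →L[ℝ] ℝ := innerSL ℝ ν

/-- The open square of half side `R` with one side orthogonal to `ν`. -/
def box (ν : Plane) (R : ℝ) : Set Plane := {x | |along ν x| < R ∧ |height ν x| < R}

section Frame

variable {ν : Plane}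

lemma inner_eq_coord (x y : Plane) : inner ℝ x y = x 0 * y 0 + x 1 * y 1 := by
  simp only [PiLp.inner_apply, RCLike.inner_apply, conj_trivial, Fin.sum_univ_two]
  ring

lemma norm_sq_eq_coord (x : Plane) : ‖x‖ ^ 2 = x 0 ^ 2 + x 1 ^ 2 := by
  rw [← real_inner_self_eq_norm_sq, inner_eq_coord]
  ring

lemma inner_perp_self (ν : Plane) : inner ℝ (perp ν) ν = 0 := by
  simp [inner_eq_coord, perp, mul_comm]

lemma norm_perp (ν : Plane) : ‖perp ν‖ = ‖ν‖ := by
  rw [← sq_eq_sq₀ (norm_nonneg _) (norm_nonneg _), norm_sq_eq_coord, norm_sq_eq_coord]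
  simp [perp, add_comm]

lemma along_perp (hν : ‖ν‖ = 1) : along ν (perp ν) = 1 := by
  simp [along, norm_perp, hν]

lemma height_perp (ν : Plane) : height ν (perp ν) = 0 := by
  rw [height, innerSL_apply_apply, real_inner_comm, inner_perp_self]

lemma height_self (hν : ‖ν‖ = 1) : height ν ν = 1 := by
  simp [height, hν]

lemma abs_along_le (hν : ‖ν‖ = 1) (x : Plane) : |along ν x| ≤ ‖x‖ := by
  simpa [along, norm_perp, hν] using abs_real_inner_le_norm (perp ν) x

lemma abs_height_le (hν : ‖ν‖ = 1) (x : Plane) : |height ν x| ≤ ‖x‖ := by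
  simpa [height, hν] using abs_real_inner_le_norm ν x

lemma abs_along_sub_le (hν : ‖ν‖ = 1) (x y : Plane) : |along ν x - along ν y| ≤ dist x y := by
  rw [← map_sub, dist_eq_norm]
  exact abs_along_le hν _

lemma abs_height_sub_le (hν : ‖ν‖ = 1) (x y : Plane) :
    |height ν x - height ν y| ≤ dist x y := by
  rw [← map_sub, dist_eq_norm]
  exact abs_height_le hν _

lemma square_eq_box (ν : Plane) : square ν = box ν (1 / 2) := by
  ext x
  simp only [square, rect, box, along, height, innerSL_apply_apply, Set.mem_ofPred_eq,
    real_inner_comm]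

lemma smul_mem_box_iff {ε : ℝ} (hε : 0 < ε) {x : Plane} {R : ℝ} :
    ε • x ∈ box ν R ↔ x ∈ box ν (R / ε) := by
  simp only [box, Set.mem_ofPred_eq, map_smul, smul_eq_mul, abs_mul, abs_of_pos hε,
    lt_div_iff₀' hε]

lemma mem_box_add_of_dist_lt (hν : ‖ν‖ = 1) {x y : Plane} {R d : ℝ} (hx : x ∈ box ν R)
    (hxy : dist x y < d) : y ∈ box ν (R + d) := by
  have ha := (abs_sub_abs_le_abs_sub _ _).trans (abs_along_sub_le hν y x)
  have hh := (abs_sub_abs_le_abs_sub _ _).trans (abs_height_sub_le hν y x)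
  rw [dist_comm] at ha hh
  exact ⟨by linarith [hx.1], by linarith [hx.2]⟩

lemma box_eq_inter (ν : Plane) (R : ℝ) :
    box ν R = along ν ⁻¹' Set.Ioo (-R) R ∩ height ν ⁻¹' Set.Ioo (-R) R := by
  ext x
  simp only [box, Set.mem_ofPred_eq, abs_lt, Set.mem_inter_iff, Set.mem_preimage, Set.mem_Ioo]

lemma isOpen_box (ν : Plane) (R : ℝ) : IsOpen (box ν R) := by
  rw [box_eq_inter]
  exact (isOpen_Ioo.preimage (along ν).continuous).inter
    (isOpen_Ioo.preimage (height ν).continuous)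

lemma convex_box (ν : Plane) (R : ℝ) : Convex ℝ (box ν R) := by
  rw [box_eq_inter]
  exact ((convex_Ioo _ _).linear_preimage (along ν).toLinearMap).inter
    ((convex_Ioo _ _).linear_preimage (height ν).toLinearMap)

lemma orthonormal_perp (hν : ‖ν‖ = 1) : Orthonormal ℝ ![perp ν, ν] := by
  have h := inner_perp_self ν
  have h' := (real_inner_comm (perp ν) ν).trans h
  rw [orthonormal_iff_ite]
  intro i j
  fin_cases i <;> fin_cases j <;> simp [h, h', norm_perp, hν]

lemma volume_along_height_Icc (hν : ‖ν‖ = 1) (a b c d : ℝ) :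
    volume {x : Plane | along ν x ∈ Set.Icc a b ∧ height ν x ∈ Set.Icc c d}
      = ENNReal.ofReal (b - a) * ENNReal.ofReal (d - c) := by
  have hon := orthonormal_perp hν
  let B := OrthonormalBasis.mk hon
    (hon.linearIndependent.span_eq_top_of_card_eq_finrank (by simp)).ge
  let f : Plane → Fin 2 → ℝ := fun x => (MeasurableEquiv.toLp 2 (Fin 2 → ℝ)).symm (B.repr x)
  have hf : MeasurePreserving f volume volume :=
    (EuclideanSpace.volume_preserving_symm_measurableEquiv_toLp (Fin 2)).comp
      B.measurePreserving_repr
  have hf_apply : ∀ x i, f x i = inner ℝ (![perp ν, ν] i) x := fun x i =>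
    (B.repr_apply_apply x i).trans (by rw [OrthonormalBasis.coe_mk])
  have hset : {x : Plane | along ν x ∈ Set.Icc a b ∧ height ν x ∈ Set.Icc c d}
      = f ⁻¹' Set.Icc ![a, c] ![b, d] := by
    ext x
    simp only [Set.mem_ofPred_eq, Set.mem_Icc, Set.mem_preimage, Pi.le_def, Fin.forall_fin_two,
      hf_apply, Matrix.cons_val_zero, Matrix.cons_val_one, along, height, innerSL_apply_apply]
    tauto
  rw [hset, hf.measure_preimage measurableSet_Icc.nullMeasurableSet, Real.volume_Icc_pi]
  simp [Fin.prod_univ_two]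

end Frame

/-! ### Lattice coordinates -/

/-- The first coordinate with respect to the basis `e₁, e₂`. -/
def coordA : Plane →L[ℝ] ℝ := innerSL ℝ !₂[1, -(1 / √3)]

/-- The second coordinate with respect to the basis `e₁, e₂`. -/
def coordB : Plane →L[ℝ] ℝ := innerSL ℝ !₂[0, 2 / √3]

lemma coordA_apply (x : Plane) : coordA x = x 0 - x 1 / √3 := by
  simp [coordA, inner_eq_coord]
  ring

lemma coordB_apply (x : Plane) : coordB x = 2 * x 1 / √3 := by
  simp [coordB, inner_eq_coord]
  ring

lemma coord_smul_add_coord_smul (x : Plane) : coordA x • e₁ + coordB x • e₂ = x := by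
  have h3 : √3 ≠ 0 := by positivity
  ext i
  fin_cases i
  · simp [coordA_apply, coordB_apply, e₁, e₂]
    ring
  · simp [coordA_apply, coordB_apply, e₁, e₂]
    field_simp

lemma ext_coord {x y : Plane} (hA : coordA x = coordA y) (hB : coordB x = coordB y) : x = y := by
  rw [← coord_smul_add_coord_smul x, ← coord_smul_add_coord_smul y, hA, hB]

@[simp] lemma coordA_e₁ : coordA e₁ = 1 := by simp [coordA_apply, e₁]

@[simp] lemma coordB_e₁ : coordB e₁ = 0 := by simp [coordB_apply, e₁]

@[simp] lemma coordA_e₂ : coordA e₂ = 0 := by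
  simp [coordA_apply, e₂]
  field_simp
  ring

@[simp] lemma coordB_e₂ : coordB e₂ = 1 := by
  simp [coordB_apply, e₂]
  field_simp

lemma norm_sq_eq_coordA_coordB (x : Plane) :
    ‖x‖ ^ 2 = coordA x ^ 2 + coordA x * coordB x + coordB x ^ 2 := by
  have h3 : √3 ^ 2 = 3 := Real.sq_sqrt (by norm_num)
  rw [norm_sq_eq_coord, coordA_apply, coordB_apply]
  field_simp
  linear_combination (x 1 ^ 2) * h3

lemma mem_lattice_iff {x : Plane} : x ∈ lattice ↔ ∃ m n : ℤ, coordA x = m ∧ coordB x = n := by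
  constructor
  · rintro ⟨m, n, rfl⟩
    exact ⟨m, n, by simp, by simp⟩
  · rintro ⟨m, n, hm, hn⟩
    exact ⟨m, n, by rw [← hm, ← hn, coord_smul_add_coord_smul]⟩

lemma mem_sublattice_iff {α : Fin 3} {x : Plane} :
    x ∈ sublattice α ↔ ∃ m n : ℤ, coordA x = m ∧ coordB x = n ∧ m - n ≡ α [ZMOD 3] := by
  have hA : ∀ z₁ z₂ : ℝ, coordA (z₁ • (e₁ + e₂) + z₂ • (e₂ + e₃) + offset α)
      = z₁ - z₂ + (![0, 1, 0] α : ℤ) := by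
    intro z₁ z₂
    fin_cases α <;> simp [e₃_eq, offset] <;> ring
  have hB : ∀ z₁ z₂ : ℝ, coordB (z₁ • (e₁ + e₂) + z₂ • (e₂ + e₃) + offset α)
      = z₁ + 2 * z₂ + (![0, 0, 1] α : ℤ) := by
    intro z₁ z₂
    fin_cases α <;> simp [e₃_eq, offset] <;> ring
  have hα : (![0, 1, 0] α - ![0, 0, 1] α : ℤ) ≡ α [ZMOD 3] := by
    fin_cases α <;> rfl
  constructor
  · rintro ⟨z₁, z₂, rfl⟩
    refine ⟨z₁ - z₂ + ![0, 1, 0] α, z₁ + 2 * z₂ + ![0, 0, 1] α, ?_, ?_, ?_⟩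
    · rw [hA]
      push_cast
      ring
    · rw [hB]
      push_cast
      ring
    · unfold Int.ModEq at hα ⊢
      lia
  · rintro ⟨m, n, hm, hn, hmn⟩
    obtain ⟨k, hk⟩ := (hmn.trans hα.symm).dvd
    refine ⟨m + k - ![0, 1, 0] α, k, ext_coord ?_ ?_⟩
    · rw [hA, hm]
      push_cast
      ring
    · rw [hB, hn, show n = m + 3 * k - ![0, 1, 0] α + ![0, 0, 1] α by lia]
      push_cast
      ring

lemma eq_of_mem_sublattice {α β : Fin 3} {x : Plane} (hα : x ∈ sublattice α)
    (hβ : x ∈ sublattice β) : α = β := by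
  obtain ⟨m, n, hm, hn, hmn⟩ := mem_sublattice_iff.1 hα
  obtain ⟨m', n', hm', hn', hmn'⟩ := mem_sublattice_iff.1 hβ
  obtain rfl : m = m' := Int.cast_injective (hm.symm.trans hm')
  obtain rfl : n = n' := Int.cast_injective (hn.symm.trans hn')
  have h : (α : ℤ) % 3 = (β : ℤ) % 3 := hmn.symm.trans hmn'
  exact Fin.ext (by omega)

lemma add_mem_sublattice {α : Fin 3} {x t : Plane} (hx : x ∈ sublattice α)
    (ht : t ∈ sublattice 0) : x + t ∈ sublattice α := by
  obtain ⟨m, n, hm, hn, hmn⟩ := mem_sublattice_iff.1 hx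
  obtain ⟨m', n', hm', hn', hmn'⟩ := mem_sublattice_iff.1 ht
  refine mem_sublattice_iff.2 ⟨m + m', n + n', by simp [hm, hm'], by simp [hn, hn'], ?_⟩
  simpa [add_sub_add_comm] using hmn.add hmn'

lemma neg_mem_sublattice_zero {t : Plane} (ht : t ∈ sublattice 0) : -t ∈ sublattice 0 := by
  obtain ⟨m, n, hm, hn, hmn⟩ := mem_sublattice_iff.1 ht
  refine mem_sublattice_iff.2 ⟨-m, -n, by simp [hm], by simp [hn], ?_⟩
  simpa [neg_add_eq_sub] using hmn.neg

lemma add_mem_sublattice_iff {α : Fin 3} {x t : Plane} (ht : t ∈ sublattice 0) :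
    x + t ∈ sublattice α ↔ x ∈ sublattice α :=
  ⟨fun h => by simpa using add_mem_sublattice h (neg_mem_sublattice_zero ht),
    fun h => add_mem_sublattice h ht⟩

lemma exists_mem_sublattice_zero_dist_le (x : Plane) : ∃ t ∈ sublattice 0, dist t x ≤ 2 := by
  have h₁ : ‖e₁ + e₂‖ ≤ 2 := by
    have := norm_sq_eq_coordA_coordB (e₁ + e₂)
    simp only [map_add, coordA_e₁, coordA_e₂, coordB_e₁, coordB_e₂] at this
    nlinarith [norm_nonneg (e₁ + e₂)]
  have h₂ : ‖e₂ + e₃‖ ≤ 2 := by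
    have := norm_sq_eq_coordA_coordB (e₂ + e₃)
    simp only [e₃_eq, map_add, map_sub, coordA_e₁, coordA_e₂, coordB_e₁, coordB_e₂] at this ⊢
    nlinarith [norm_nonneg (e₂ + (e₂ - e₁))]
  let b := (coordB x - coordA x) / 3
  let a := coordA x + b
  have hx : a • (e₁ + e₂) + b • (e₂ + e₃) = x := by
    apply ext_coord
    · simp [e₃_eq, a, b]
    · simp [e₃_eq, a, b]
      ring
  refine ⟨(round a : ℝ) • (e₁ + e₂) + (round b : ℝ) • (e₂ + e₃),
    ⟨round a, round b, by simp [offset]⟩, ?_⟩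
  calc dist ((round a : ℝ) • (e₁ + e₂) + (round b : ℝ) • (e₂ + e₃)) x
      = dist x ((round a : ℝ) • (e₁ + e₂) + (round b : ℝ) • (e₂ + e₃)) := dist_comm _ _
    _ = ‖(a - round a) • (e₁ + e₂) + (b - round b) • (e₂ + e₃)‖ := by
        conv_lhs => rw [← hx, dist_eq_norm]
        congr 1
        module
    _ ≤ |a - round a| * ‖e₁ + e₂‖ + |b - round b| * ‖e₂ + e₃‖ := by
        simpa only [norm_smul, Real.norm_eq_abs] using
          norm_add_le ((a - round a) • (e₁ + e₂)) ((b - round b) • (e₂ + e₃))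
    _ ≤ 1 / 2 * 2 + 1 / 2 * 2 := by gcongr <;> apply abs_sub_round
    _ = 2 := by norm_num

/-! ### Triangles -/

namespace Triangle

lemma ext_vertex {T T' : Triangle} (h : ∀ α, T.vertex α = T'.vertex α) : T = T' := by
  cases T
  cases T'
  congr
  exact funext h

lemma mem_lattice (T : Triangle) (α : Fin 3) : T.vertex α ∈ lattice :=
  sublattice_subset α (T.mem α)

lemma norm_sub (T : Triangle) {α β : Fin 3} (h : α ≠ β) : ‖T.vertex α - T.vertex β‖ = 1 := by
  rw [← dist_eq_norm, T.dist_eq α β h]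

lemma dist_le (T : Triangle) (α β : Fin 3) : dist (T.vertex α) (T.vertex β) ≤ 1 := by
  rcases eq_or_ne α β with rfl | h
  · simp
  · exact (T.dist_eq α β h).le

lemma hull_subset_closedBall (T : Triangle) {ε : ℝ} (hε : 0 < ε) (α : Fin 3) :
    T.hull ε ⊆ Metric.closedBall (ε • T.vertex α) ε := by
  refine convexHull_min ?_ (convex_closedBall _ _)
  rintro _ ⟨β, rfl⟩
  rw [Metric.mem_closedBall, dist_smul₀, Real.norm_eq_abs, abs_of_pos hε]
  exact mul_le_of_le_one_right hε.le (T.dist_le β α)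

lemma dist_vertex_le_one (T : Triangle) {x : Plane} (hx : x ∈ T.hull 1) (α : Fin 3) :
    dist x (T.vertex α) ≤ 1 := by
  simpa using T.hull_subset_closedBall one_pos α hx

end Triangle

lemma abs_le_one_of_sq_add_mul_add_sq_eq_one {m n : ℤ} (h : m ^ 2 + m * n + n ^ 2 = 1) :
    |m| ≤ 1 ∧ |n| ≤ 1 ∧ |m + n| ≤ 1 := by
  simp only [abs_le_one_iff_mul_self_le_one]
  refine ⟨?_, ?_, ?_⟩
  · nlinarith [sq_nonneg (m + 2 * n)]
  · nlinarith [sq_nonneg (n + 2 * m)]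
  · nlinarith [sq_nonneg (m - n)]

/-- The three functionals whose level lines through the lattice points are the lattice lines. -/
def latticeFunctional : Fin 3 → Plane →L[ℝ] ℝ := ![coordA, coordB, coordA + coordB]

lemma latticeFunctional_ne_zero (i : Fin 3) : latticeFunctional i ≠ 0 := by
  have : latticeFunctional i (e₁ + e₂) ≠ 0 := by
    fin_cases i <;> simp [latticeFunctional]
  exact fun h => this (by simp [h])

namespace Triangle

lemma dist_latticeFunctional_le (T : Triangle) (i α β : Fin 3) :
    dist (latticeFunctional i (T.vertex β)) (latticeFunctional i (T.vertex α)) ≤ 1 := by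
  rcases eq_or_ne β α with rfl | hne
  · simp
  obtain ⟨m, n, hm, hn⟩ := mem_lattice_iff.1 (T.mem_lattice α)
  obtain ⟨m', n', hm', hn'⟩ := mem_lattice_iff.1 (T.mem_lattice β)
  have hnorm := norm_sq_eq_coordA_coordB (T.vertex β - T.vertex α)
  rw [T.norm_sub hne, map_sub, map_sub, hm, hn, hm', hn'] at hnorm
  obtain ⟨hA, hB, hAB⟩ := abs_le_one_of_sq_add_mul_add_sq_eq_one (m := m' - m) (n := n' - n)
    (by exact_mod_cast hnorm.symm)
  rw [sub_add_sub_comm] at hAB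
  rw [Real.dist_eq]
  fin_cases i
  · simpa [latticeFunctional, hm, hm'] using mod_cast hA
  · simpa [latticeFunctional, hn, hn'] using mod_cast hB
  · simpa [latticeFunctional, hm, hn, hm', hn'] using mod_cast hAB

lemma dist_map_lt_of_mem_interior (T : Triangle) {ε : ℝ} (hε : 0 < ε) {L : Plane →L[ℝ] ℝ}
    (hL : L ≠ 0) {α : Fin 3} (h : ∀ β, dist (L (T.vertex β)) (L (T.vertex α)) ≤ 1) {x : Plane}
    (hx : x ∈ interior (T.hull ε)) : dist (L x) (ε * L (T.vertex α)) < ε := by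
  have hsub : T.hull ε ⊆ L ⁻¹' Metric.closedBall (ε * L (T.vertex α)) ε := by
    refine convexHull_min ?_ ((convex_closedBall _ _).linear_preimage L.toLinearMap)
    rintro _ ⟨β, rfl⟩
    rw [Set.mem_preimage, Metric.mem_closedBall, map_smul, smul_eq_mul, ← smul_eq_mul,
      ← smul_eq_mul, dist_smul₀, Real.norm_eq_abs, abs_of_pos hε]
    exact mul_le_of_le_one_right hε.le (h β)
  have := interior_mono hsub hx
  rwa [← (L.isOpenMap_of_ne_zero hL).preimage_interior_eq_interior_preimage L.continuous,
    interior_closedBall _ hε.ne'] at this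

lemma dist_latticeFunctional_lt_two {T T' : Triangle} {ε : ℝ} (hε : 0 < ε) {x : Plane}
    (hx : x ∈ interior (T.hull ε)) (hx' : x ∈ interior (T'.hull ε)) (i α : Fin 3) :
    dist (latticeFunctional i (T.vertex α)) (latticeFunctional i (T'.vertex α)) < 2 := by
  have hL := latticeFunctional_ne_zero i
  have h := T.dist_map_lt_of_mem_interior hε hL (T.dist_latticeFunctional_le i α) hx
  have h' := T'.dist_map_lt_of_mem_interior hε hL (T'.dist_latticeFunctional_le i α) hx'
  have htri := (dist_triangle_left _ _ (latticeFunctional i x)).trans_lt (add_lt_add h h')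
  rw [← smul_eq_mul, ← smul_eq_mul, dist_smul₀, Real.norm_eq_abs, abs_of_pos hε] at htri
  nlinarith

/-- The vertices of the two triangles in one sublattice are at most a lattice bond apart, hence
equal, since a bond never joins two points of the same sublattice. -/
lemma eq_of_mem_interior {T T' : Triangle} {ε : ℝ} (hε : 0 < ε) {x : Plane}
    (hx : x ∈ interior (T.hull ε)) (hx' : x ∈ interior (T'.hull ε)) : T = T' := by
  refine ext_vertex fun α => ?_
  obtain ⟨m, n, hm, hn, hmn⟩ := mem_sublattice_iff.1 (T.mem α)
  obtain ⟨m', n', hm', hn', hmn'⟩ := mem_sublattice_iff.1 (T'.mem α)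
  have h := fun i => dist_latticeFunctional_lt_two hε hx hx' i α
  have hA := h 0
  have hB := h 1
  have hAB := h 2
  simp only [latticeFunctional, Matrix.cons_val, add_apply, Real.dist_eq, hm, hn, hm', hn']
    at hA hB hAB
  norm_cast at hA hB hAB
  have hmod : (m - n) % 3 = (m' - n') % 3 := hmn.trans hmn'.symm
  obtain ⟨rfl, rfl⟩ : m = m' ∧ n = n' := by
    rw [abs_sub_lt_iff] at hA hB hAB
    omega
  exact ext_coord (hm.trans hm'.symm) (hn.trans hn'.symm)

end Triangle

/-- The vectors `(4 a - 2 b) / 3` and `(4 b - 2 a) / 3` form the dual basis of `a`, `b`. -/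
lemma eq_combination_of_inner_eq_half {a b : Plane} (ha : ‖a‖ = 1) (hb : ‖b‖ = 1)
    (hab : inner ℝ a b = 1 / 2) (y : Plane) :
    y = inner ℝ ((4 / 3 : ℝ) • a + (-2 / 3 : ℝ) • b) y • a
      + inner ℝ ((4 / 3 : ℝ) • b + (-2 / 3 : ℝ) • a) y • b := by
  have haa := norm_sq_eq_coord a
  have hbb := norm_sq_eq_coord b
  rw [ha] at haa
  rw [hb] at hbb
  rw [inner_eq_coord] at hab
  let D := a 0 * b 1 - a 1 * b 0
  have hDa₀ : D * a 0 = b 1 - a 1 / 2 := by linear_combination (-b 1) * haa - a 1 * hab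
  have hDa₁ : D * a 1 = a 0 / 2 - b 0 := by linear_combination b 0 * haa + a 0 * hab
  have hDb₀ : D * b 0 = b 1 / 2 - a 1 := by linear_combination a 1 * hbb + b 1 * hab
  have hDb₁ : D * b 1 = a 0 - b 0 / 2 := by linear_combination (-a 0) * hbb - b 0 * hab
  have hDD : D ^ 2 = 3 / 4 := by linear_combination a 0 * hDb₁ - a 1 * hDb₀ - haa - hab / 2
  ext i
  simp only [inner_eq_coord, PiLp.add_apply, PiLp.smul_apply, smul_eq_mul]
  match i with
  | 0 => linear_combination (4 / 3 * (a 0 * y 0 + a 1 * y 1)) * hDb₁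
      - (4 / 3 * (b 0 * y 0 + b 1 * y 1)) * hDa₁ - 4 / 3 * y 0 * hDD
  | 1 => linear_combination (-(4 / 3) * (a 0 * y 0 + a 1 * y 1)) * hDb₀
      + (4 / 3 * (b 0 * y 0 + b 1 * y 1)) * hDa₀ - 4 / 3 * y 1 * hDD

lemma abs_inner_smul_add_smul_le {E : Type*} [NormedAddCommGroup E] [InnerProductSpace ℝ E]
    {a b : E} (ha : ‖a‖ = 1) (hb : ‖b‖ = 1) (s t : ℝ) (y : E) :
    |inner ℝ (s • a + t • b) y| ≤ (|s| + |t|) * ‖y‖ := by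
  refine (abs_real_inner_le_norm _ _).trans (mul_le_mul_of_nonneg_right ?_ (norm_nonneg y))
  simpa [norm_smul, ha, hb] using norm_add_le (s • a) (t • b)

namespace Triangle

/-- The centroid of the triangle scaled by `ε`. -/
def center (T : Triangle) (ε : ℝ) : Plane :=
  (ε / 3) • (T.vertex 0 + T.vertex 1 + T.vertex 2)

lemma inner_vertex_sub_vertex (T : Triangle) :
    inner ℝ (T.vertex 1 - T.vertex 0) (T.vertex 2 - T.vertex 0) = (1 / 2 : ℝ) := by
  have h := norm_sub_sq_real (T.vertex 1 - T.vertex 0) (T.vertex 2 - T.vertex 0)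
  rw [sub_sub_sub_cancel_right, T.norm_sub (by decide), T.norm_sub (by decide),
    T.norm_sub (by decide)] at h
  linarith

lemma ball_subset_hull (T : Triangle) {ε : ℝ} (hε : 0 < ε) :
    Metric.ball (T.center ε) (ε / 6) ⊆ T.hull ε := by
  intro x hx
  let a := T.vertex 1 - T.vertex 0
  let b := T.vertex 2 - T.vertex 0
  have ha : ‖a‖ = 1 := T.norm_sub (by decide)
  have hb : ‖b‖ = 1 := T.norm_sub (by decide)
  have hab : inner ℝ a b = 1 / 2 := T.inner_vertex_sub_vertex
  let y := ε⁻¹ • (x - T.center ε)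
  have hxy : x = T.center ε + ε • y := by
    rw [smul_inv_smul₀ hε.ne', add_sub_cancel]
  have hy : ‖y‖ ≤ 1 / 6 := by
    rw [Metric.mem_ball, dist_eq_norm] at hx
    rw [norm_smul, norm_inv, Real.norm_eq_abs, abs_of_pos hε, inv_mul_le_iff₀ hε]
    linarith
  let s := inner ℝ ((4 / 3 : ℝ) • a + (-2 / 3 : ℝ) • b) y
  let t := inner ℝ ((4 / 3 : ℝ) • b + (-2 / 3 : ℝ) • a) y
  have hyst : y = s • a + t • b := eq_combination_of_inner_eq_half ha hb hab y
  have hs : |s| ≤ 1 / 3 := (abs_inner_smul_add_smul_le ha hb _ _ y).trans (by norm_num; linarith)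
  have ht : |t| ≤ 1 / 3 := (abs_inner_smul_add_smul_le hb ha _ _ y).trans (by norm_num; linarith)
  have hst : |s + t| ≤ 1 / 3 := by
    have h : s + t = inner ℝ ((2 / 3 : ℝ) • a + (2 / 3 : ℝ) • b) y := by
      rw [← inner_add_left]
      congr 1
      module
    rw [h]
    exact (abs_inner_smul_add_smul_le ha hb _ _ y).trans (by norm_num; linarith)
  have hx' : x = ∑ α, ![1 / 3 - (s + t), 1 / 3 + s, 1 / 3 + t] α • (ε • T.vertex α) := by
    rw [hxy, hyst, center, Fin.sum_univ_three]
    simp only [Matrix.cons_val, a, b]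
    module
  rw [hx', hull]
  refine (convex_convexHull ℝ _).sum_mem ?_ ?_ fun α _ => subset_convexHull ℝ _ ⟨α, rfl⟩
  · intro α _
    rw [abs_le] at hs ht hst
    fin_cases α <;>
      simp only [Fin.reduceFinMk, Fin.zero_eta, Fin.mk_one, Matrix.cons_val] <;>
      linarith
  · rw [Fin.sum_univ_three]
    simp only [Matrix.cons_val]
    ring

end Triangle

lemma volume_ball_ge (x : Plane) {ε : ℝ} (hε : 0 < ε) :
    ENNReal.ofReal (ε ^ 2 / 12) ≤ volume (Metric.ball x (ε / 6)) := by
  rw [EuclideanSpace.volume_ball_fin_two, ← ENNReal.ofReal_pow (by positivity),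
    ← NNReal.coe_real_pi, ← ENNReal.ofReal_mul (by positivity), NNReal.coe_real_pi]
  apply ENNReal.ofReal_le_ofReal
  nlinarith [Real.pi_gt_three, sq_nonneg ε]

lemma pairwise_disjoint_ball_center {ε : ℝ} (hε : 0 < ε) :
    Pairwise (Function.onFun Disjoint fun T : Triangle => Metric.ball (T.center ε) (ε / 6)) := by
  intro T T' hne
  have hball : ∀ T : Triangle, Metric.ball (T.center ε) (ε / 6) ⊆ interior (T.hull ε) :=
    fun T => interior_maximal (T.ball_subset_hull hε) Metric.isOpen_ball
  exact Set.disjoint_left.2 fun x hx hx' =>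
    hne (Triangle.eq_of_mem_interior hε (hball T hx) (hball T' hx'))

lemma card_mul_le_volume_of_ball_subset {ε : ℝ} (hε : 0 < ε) (s : Finset Triangle)
    {A : Set Plane} (h : ∀ T ∈ s, Metric.ball (T.center ε) (ε / 6) ⊆ A) :
    ENNReal.ofReal (s.card * (ε ^ 2 / 12)) ≤ volume A :=
  calc ENNReal.ofReal (s.card * (ε ^ 2 / 12))
      = s.card • ENNReal.ofReal (ε ^ 2 / 12) := by
        rw [ENNReal.ofReal_mul (by positivity), ENNReal.ofReal_natCast, nsmul_eq_mul]
    _ ≤ ∑ T ∈ s, volume (Metric.ball (T.center ε) (ε / 6)) :=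
        Finset.card_nsmul_le_sum _ _ _ fun T _ => volume_ball_ge _ hε
    _ = volume (⋃ T ∈ s, Metric.ball (T.center ε) (ε / 6)) :=
        (measure_biUnion_finset ((pairwise_disjoint_ball_center hε).set_pairwise _)
          fun T _ => measurableSet_ball).symm
    _ ≤ volume A := measure_mono (Set.iUnion₂_subset h)

lemma card_le_of_vertex_mem_rect {ν : Plane} (hν : ‖ν‖ = 1) (s : Finset Triangle) {a b c d : ℝ}
    (hab : a ≤ b) (hcd : c ≤ d)
    (h : ∀ T ∈ s, ∃ α, along ν (T.vertex α) ∈ Set.Icc a b ∧ height ν (T.vertex α) ∈ Set.Icc c d) :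
    (s.card : ℝ) ≤ 12 * ((b - a + 2) * (d - c + 2)) := by
  have hball : ∀ T ∈ s, Metric.ball (T.center 1) (1 / 6) ⊆
      {x : Plane | along ν x ∈ Set.Icc (a - 1) (b + 1) ∧ height ν x ∈ Set.Icc (c - 1) (d + 1)} := by
    intro T hT x hx
    obtain ⟨α, ⟨ha, hb⟩, hc, hd⟩ := h T hT
    have hdist := T.dist_vertex_le_one (T.ball_subset_hull one_pos hx) α
    have halong := abs_le.1 ((abs_along_sub_le hν _ _).trans hdist)
    have hheight := abs_le.1 ((abs_height_sub_le hν _ _).trans hdist)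
    exact ⟨⟨by linarith, by linarith⟩, ⟨by linarith, by linarith⟩⟩
  have hcard := card_mul_le_volume_of_ball_subset one_pos s hball
  rw [volume_along_height_Icc hν, ← ENNReal.ofReal_mul (by linarith),
    ENNReal.ofReal_le_ofReal_iff (mul_nonneg (by linarith) (by linarith))] at hcard
  linarith

/-! ### Fields on the unit lattice -/

/-- The energy of a field on the unit lattice in one triangle. -/
def cost (W : Plane → Circle) (T : Triangle) : ℝ :=
  ‖∑ α, (W (T.vertex α) : ℂ)‖ ^ 2

open Classical in
/-- A spin field, transported to the unit lattice and extended by `1` to the plane. -/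
def SpinField.toUnit {ε : ℝ} (u : SpinField ε) : Plane → Circle := fun p =>
  if h : ε • p ∈ (ε • lattice : Set Plane) then u ⟨ε • p, h⟩ else 1

/-- The spin field on the scaled lattice given by a field on the plane. -/
def SpinField.ofUnit (ε : ℝ) (W : Plane → Circle) : SpinField ε := fun x => W (ε⁻¹ • (x : Plane))

/-- The triangles with all vertices in the open square of half side `R`. -/
def tri (ν : Plane) (R : ℝ) : Set Triangle := {T | ∀ α, T.vertex α ∈ box ν R}

section Energy

variable {ν : Plane} {ε : ℝ}

lemma cost_nonneg (W : Plane → Circle) (T : Triangle) : 0 ≤ cost W T := sq_nonneg _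

lemma cost_le (W : Plane → Circle) (T : Triangle) : cost W T ≤ 9 := by
  have h : ‖∑ α, (W (T.vertex α) : ℂ)‖ ≤ 3 := by
    simpa [Circle.norm_coe] using norm_sum_le Finset.univ fun α => (W (T.vertex α) : ℂ)
  calc cost W T ≤ 3 ^ 2 := pow_le_pow_left₀ (norm_nonneg _) h 2
    _ = 9 := by norm_num

lemma cost_congr {W W' : Plane → Circle} {T T' : Triangle}
    (h : ∀ α, W (T.vertex α) = W' (T'.vertex α)) : cost W T = cost W' T' := by
  simp only [cost, h]

lemma tri_finite (hν : ‖ν‖ = 1) (R : ℝ) : (tri ν R).Finite := by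
  by_contra hinf
  obtain ⟨n, hn⟩ := exists_nat_gt (12 * ((|R| - -|R| + 2) * (|R| - -|R| + 2)))
  obtain ⟨s, hs, rfl⟩ := Set.Infinite.exists_subset_card_eq hinf n
  have hR : -|R| ≤ |R| := neg_le_self (abs_nonneg R)
  refine hn.not_ge (card_le_of_vertex_mem_rect hν s hR hR fun T hT => ⟨0, ?_⟩)
  obtain ⟨ha, hh⟩ := hs hT 0
  exact ⟨abs_le.1 (ha.le.trans (le_abs_self R)), abs_le.1 (hh.le.trans (le_abs_self R))⟩

open Classical in
/-- The set `tri ν R` as a finset; it is finite when `ν` is a unit vector, and `triF ν R` has the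
junk value `∅` otherwise. -/
def triF (ν : Plane) (R : ℝ) : Finset Triangle :=
  if h : (tri ν R).Finite then h.toFinset else ∅

lemma coe_triF (hν : ‖ν‖ = 1) (R : ℝ) : (triF ν R : Set Triangle) = tri ν R := by
  rw [triF, dif_pos (tri_finite hν R), Set.Finite.coe_toFinset]

lemma mem_triF (hν : ‖ν‖ = 1) {R : ℝ} {T : Triangle} :
    T ∈ triF ν R ↔ ∀ α, T.vertex α ∈ box ν R := by
  rw [← Finset.mem_coe, coe_triF hν]
  rfl

lemma hull_subset_square_iff (hε : 0 < ε) {T : Triangle} :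
    T.hull ε ⊆ square ν ↔ T ∈ tri ν (1 / 2 / ε) := by
  rw [Triangle.hull, square_eq_box, (convex_box ν _).convexHull_subset_iff, Set.range_subset_iff]
  exact forall_congr' fun α => smul_mem_box_iff hε

namespace SpinField

lemma toUnit_apply (u : SpinField ε) {p : Plane} (hp : p ∈ lattice) :
    u.toUnit p = u ⟨ε • p, Set.smul_mem_smul_set hp⟩ :=
  dif_pos _

lemma toUnit_ofUnit (hε : 0 < ε) (W : Plane → Circle) {p : Plane} (hp : p ∈ lattice) :
    (ofUnit ε W).toUnit p = W p := by
  rw [toUnit_apply _ hp, ofUnit, inv_smul_smul₀ hε.ne']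

lemma toUnit_vertex (u : SpinField ε) (T : Triangle) (α : Fin 3) :
    (u.toUnit (T.vertex α) : ℂ) = SpinField.at u T α := by
  rw [toUnit_apply u (T.mem_lattice α)]
  rfl

lemma cost_toUnit_ofUnit (hε : 0 < ε) (W : Plane → Circle) (T : Triangle) :
    cost (ofUnit ε W).toUnit T = cost W T :=
  cost_congr fun α => toUnit_ofUnit hε W (T.mem_lattice α)

end SpinField

lemma triangleEnergy_eq (u : SpinField ε) (T : Triangle) :
    triangleEnergy u T = ε * cost u.toUnit T := by
  simp only [triangleEnergy, cost, u.toUnit_vertex, Fin.sum_univ_three]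

lemma energy_square_eq (hν : ‖ν‖ = 1) (hε : 0 < ε) (u : SpinField ε) :
    energy u (square ν) = ENNReal.ofReal (ε * ∑ T ∈ triF ν (1 / 2 / ε), cost u.toUnit T) := by
  have hset : {T : Triangle | T.hull ε ⊆ square ν} = (triF ν (1 / 2 / ε) : Set Triangle) := by
    rw [coe_triF hν]
    exact Set.ext fun T => hull_subset_square_iff hε
  calc energy u (square ν)
      = ∑' T : {T : Triangle | T.hull ε ⊆ square ν}, ENNReal.ofReal (triangleEnergy u T) := rfl
    _ = ∑ T ∈ triF ν (1 / 2 / ε), ENNReal.ofReal (triangleEnergy u T) := by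
      rw [hset, Finset.tsum_subtype' _ fun T => ENNReal.ofReal (triangleEnergy u T)]
    _ = ENNReal.ofReal (ε * ∑ T ∈ triF ν (1 / 2 / ε), cost u.toUnit T) := by
      simp only [triangleEnergy_eq, Finset.mul_sum]
      exact (ENNReal.ofReal_sum_of_nonneg fun T _ => mul_nonneg hε.le (cost_nonneg _ T)).symm

end Energy

/-! ### Ground states and boundary data -/

/-- The primitive third root of unity `e ^ (2 π i / 3)`. -/
def cubeRoot : Circle := Circle.exp (2 * Real.pi / 3)

open Classical in
/-- The ground state of chirality `+1` on the unit lattice; its inverse is the ground state of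
chirality `-1`. -/
def ground (p : Plane) : Circle :=
  if p ∈ sublattice 0 then 1 else if p ∈ sublattice 1 then cubeRoot else cubeRoot ^ 2

open Classical in
/-- The pure interface on the unit lattice: the two ground states above and below the line
orthogonal to `ν`. -/
def interface (ν : Plane) (p : Plane) : Circle :=
  if 0 ≤ height ν p then ground p else (ground p)⁻¹

lemma cubeRoot_pow_three : cubeRoot ^ 3 = 1 := by
  rw [cubeRoot, ← Circle.exp_natCast_mul]
  convert Circle.exp_two_pi using 2
  push_cast
  ring

lemma exp_four_pi_div_three : Circle.exp (4 * Real.pi / 3) = cubeRoot ^ 2 := by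
  rw [cubeRoot, ← Circle.exp_natCast_mul]
  congr 1
  push_cast
  ring

lemma inv_cubeRoot : cubeRoot⁻¹ = cubeRoot ^ 2 :=
  inv_eq_of_mul_eq_one_right (by rw [← pow_succ', cubeRoot_pow_three])

lemma inv_cubeRoot_sq : (cubeRoot ^ 2)⁻¹ = cubeRoot := by rw [← inv_cubeRoot, inv_inv]

open Classical in
lemma ground_add {p t : Plane} (ht : t ∈ sublattice 0) : ground (p + t) = ground p :=
  if_congr (add_mem_sublattice_iff ht) rfl (if_congr (add_mem_sublattice_iff ht) rfl rfl)

lemma ground_vertex (T : Triangle) (α : Fin 3) : ground (T.vertex α) = cubeRoot ^ (α : ℕ) := by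
  have h : ∀ β, T.vertex α ∈ sublattice β ↔ α = β := fun β =>
    ⟨eq_of_mem_sublattice (T.mem α), fun h => h ▸ T.mem α⟩
  simp only [ground, h]
  fin_cases α <;> simp

section Boundary

variable {ν : Plane} {ε : ℝ}

open Classical in
lemma upos_eq (hε : 0 < ε) (x : (ε • lattice : Set Plane)) :
    upos ε x = ground (ε⁻¹ • (x : Plane)) :=
  have h := fun α => Set.mem_smul_set_iff_inv_smul_mem₀ hε.ne' (sublattice α) (x : Plane)
  if_congr (h 0) Circle.exp_zero (if_congr (h 1) rfl exp_four_pi_div_three)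

open Classical in
lemma uneg_eq (hε : 0 < ε) (x : (ε • lattice : Set Plane)) :
    uneg ε x = (ground (ε⁻¹ • (x : Plane)))⁻¹ := by
  have h := fun α => Set.mem_smul_set_iff_inv_smul_mem₀ hε.ne' (sublattice α) (x : Plane)
  rw [ground, apply_ite (·⁻¹), apply_ite (·⁻¹), inv_one, inv_cubeRoot, inv_cubeRoot_sq]
  exact if_congr (h 0) Circle.exp_zero (if_congr (h 1) exp_four_pi_div_three rfl)

lemma frontier_square_nonempty (hν : ‖ν‖ = 1) : (frontier (square ν)).Nonempty := by
  rw [square_eq_box]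
  have h0 : (0 : Plane) ∈ box ν (1 / 2) := by simp [box]
  have h1 : ν ∉ box ν (1 / 2) := by
    rintro ⟨-, h⟩
    rw [height_self hν] at h
    norm_num at h
  exact nonempty_frontier_iff.2 ⟨⟨0, h0⟩, fun h => h1 (h ▸ Set.mem_univ ν)⟩

lemma infDist_frontier_le_dist {E : Type*} [NormedAddCommGroup E] [NormedSpace ℝ E]
    [FiniteDimensional ℝ E] {s : Set E} {x z : E} (hx : x ∈ s) (hz : z ∉ s) :
    Metric.infDist x (frontier s) ≤ dist x z := by
  obtain ⟨y, hy, hxy⟩ := exists_mem_frontier_infDist_compl_eq_dist hx fun h => hz (h ▸ trivial)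
  calc Metric.infDist x (frontier s) ≤ dist x y := Metric.infDist_le_dist_of_mem hy
    _ = Metric.infDist x sᶜ := hxy.symm
    _ ≤ dist x z := Metric.infDist_le_dist_of_mem hz

lemma notMem_box_of_infDist_le (hν : ‖ν‖ = 1) (hε : 0 < ε) {x : Plane}
    (h : Metric.infDist x (frontier (square ν)) ≤ 3 * ε) :
    ε⁻¹ • x ∉ box ν (1 / 2 / ε - 4) := by
  obtain ⟨y, hy, hxy⟩ := (Metric.infDist_lt_iff (frontier_square_nonempty hν)).1
    (h.trans_lt (show 3 * ε < 4 * ε by linarith))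
  rw [square_eq_box, (isOpen_box ν _).frontier_eq, ← smul_inv_smul₀ hε.ne' y] at hy
  intro hx
  refine hy.2 ((smul_mem_box_iff hε).2 ?_)
  rw [← sub_add_cancel (1 / 2 / ε) 4]
  refine mem_box_add_of_dist_lt hν hx ?_
  rwa [dist_smul₀, norm_inv, Real.norm_of_nonneg hε.le, inv_mul_lt_iff₀ hε, mul_comm]

lemma ofUnit_mem_admissible (hν : ‖ν‖ = 1) (hε : 0 < ε) {W : Plane → Circle}
    (hW : ∀ p ∉ box ν (1 / 2 / ε - 4), 3 ≤ |height ν p| → W p = interface ν p) :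
    SpinField.ofUnit ε W ∈ admissible ε ν := by
  have hheight (x : Plane) : height ν (ε⁻¹ • x) = inner ℝ ν x / ε := by
    rw [map_smul, smul_eq_mul, inv_mul_eq_div]
    rfl
  constructor
  · rintro x ⟨-, hx, hd⟩
    have h3 : 3 ≤ height ν (ε⁻¹ • (x : Plane)) := by rwa [hheight, le_div_iff₀ hε]
    rw [upos_eq hε, SpinField.ofUnit,
      hW _ (notMem_box_of_infDist_le hν hε hd) (h3.trans (le_abs_self _)), interface,
      if_pos (by linarith)]
  · rintro x ⟨-, hx, hd⟩
    have h3 : 3 ≤ -height ν (ε⁻¹ • (x : Plane)) := by rwa [hheight, ← neg_div, le_div_iff₀ hε]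
    rw [uneg_eq hε, SpinField.ofUnit,
      hW _ (notMem_box_of_infDist_le hν hε hd) (h3.trans (neg_le_abs _)), interface,
      if_neg (by linarith)]

/-- The boundary condition on the unit lattice: the field is the pure interface at the lattice
points within distance `1` of the complement of the box, except near the interface. -/
def IsClamped (ν : Plane) (R : ℝ) (W : Plane → Circle) : Prop :=
  ∀ ⦃p z : Plane⦄, p ∈ lattice → p ∈ box ν R → z ∉ box ν R → dist p z ≤ 1 → 3 ≤ |height ν p| →
    W p = interface ν p

lemma isClamped_toUnit (hε : 0 < ε) {u : SpinField ε} (hu : u ∈ admissible ε ν) :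
    IsClamped ν (1 / 2 / ε) u.toUnit := by
  intro p z hp hpbox hz hpz h3
  have hd : Metric.infDist (ε • p) (frontier (square ν)) ≤ 3 * ε := by
    rw [square_eq_box]
    refine (infDist_frontier_le_dist ((smul_mem_box_iff hε).2 hpbox)
      (mt (smul_mem_box_iff hε).1 hz)).trans ?_
    rw [dist_smul₀, Real.norm_of_nonneg hε.le]
    nlinarith
  have hinner : inner ℝ ν (ε • p) = ε * height ν p := inner_smul_right _ _ _
  have hmem := Set.smul_mem_smul_set (a := ε) hp
  rw [SpinField.toUnit_apply u hp, interface]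
  rcases le_abs.1 h3 with h | h
  · rw [hu.1 ⟨_, hmem⟩ ⟨hmem, by rw [hinner]; nlinarith, hd⟩, upos_eq hε, inv_smul_smul₀ hε.ne',
      if_pos (by linarith)]
  · rw [hu.2 ⟨_, hmem⟩ ⟨hmem, by rw [hinner]; nlinarith, hd⟩, uneg_eq hε, inv_smul_smul₀ hε.ne',
      if_neg (by linarith)]

end Boundary

/-! ### The Fourier transform of order three -/

/-- The value at the root of unity `ω` of the discrete Fourier transform of three numbers. -/
def fourier (ω : ℂ) (z : Fin 3 → ℂ) : ℂ :=
  ∑ α : Fin 3, ω ^ (α : ℕ) * z α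

section Fourier

open ComplexConjugate

variable {ω : ℂ} {z : Fin 3 → ℂ}

lemma fourier_eq (ω : ℂ) (z : Fin 3 → ℂ) : fourier ω z = z 0 + ω * z 1 + ω ^ 2 * z 2 := by
  simp [fourier, Fin.sum_univ_three]

lemma sq_add_self_add_one (hω : IsPrimitiveRoot ω 3) : ω ^ 2 + ω + 1 = 0 := by
  have h := hω.geom_sum_eq_zero (by norm_num)
  simp only [Finset.sum_range_succ, Finset.sum_range_zero] at h
  linear_combination h

lemma conj_eq_neg_one_sub (hω : IsPrimitiveRoot ω 3) : conj ω = -1 - ω := by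
  have h : conj ω * ω = 1 := by
    rw [Complex.conj_mul', hω.norm'_eq_one (by norm_num)]
    norm_num
  have hω2 := sq_add_self_add_one hω
  linear_combination (-1 - ω) * h + conj ω * hω2

lemma conj_fourier (hω : IsPrimitiveRoot ω 3) (z : Fin 3 → ℂ) :
    conj (fourier ω z) = conj (z 0) + (-1 - ω) * conj (z 1) + ω * conj (z 2) := by
  have hω2 := sq_add_self_add_one hω
  simp only [fourier_eq, map_add, map_mul, map_pow, conj_eq_neg_one_sub hω]
  linear_combination conj (z 2) * hω2

lemma conj_fourier_sq (hω : IsPrimitiveRoot ω 3) (z : Fin 3 → ℂ) :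
    conj (fourier (ω ^ 2) z) = conj (z 0) + ω * conj (z 1) + (-1 - ω) * conj (z 2) := by
  have hω2 := sq_add_self_add_one hω
  rw [conj_fourier (hω.pow_of_coprime 2 (by norm_num))]
  linear_combination (conj (z 2) - conj (z 1)) * hω2

lemma conj_fourier_one (z : Fin 3 → ℂ) :
    conj (fourier 1 z) = conj (z 0) + conj (z 1) + conj (z 2) := by
  simp [fourier_eq]

lemma parseval_three (hω : IsPrimitiveRoot ω 3) (z : Fin 3 → ℂ) :
    ‖fourier 1 z‖ ^ 2 + ‖fourier ω z‖ ^ 2 + ‖fourier (ω ^ 2) z‖ ^ 2 = 3 * ∑ α, ‖z α‖ ^ 2 := by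
  have hω2 := sq_add_self_add_one hω
  apply Complex.ofReal_injective
  push_cast
  simp only [← Complex.mul_conj']
  rw [conj_fourier hω, conj_fourier_sq hω, conj_fourier_one]
  simp only [fourier_eq, Fin.sum_univ_three]
  grind

lemma fourier_shift_eq_zero (hω : IsPrimitiveRoot ω 3) (hz : ∀ α, ‖z α‖ = 1) :
    fourier 1 z * conj (fourier ω z) + fourier ω z * conj (fourier (ω ^ 2) z)
      + fourier (ω ^ 2) z * conj (fourier 1 z) = 0 := by
  have hω2 := sq_add_self_add_one hω
  have hconj (α : Fin 3) : z α * conj (z α) = 1 := by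
    rw [Complex.mul_conj', hz]
    norm_num
  have h0 := hconj 0
  have h1 := hconj 1
  have h2 := hconj 2
  rw [conj_fourier hω, conj_fourier_sq hω, conj_fourier_one]
  simp only [fourier_eq]
  grind

/-- Three unit numbers have a vanishing shifted correlation of their Fourier coefficients, so the
smaller of two coefficients is controlled by the third. -/
lemma norm_fourier_le (hω : IsPrimitiveRoot ω 3) (hz : ∀ α, ‖z α‖ = 1)
    (h : ‖fourier ω z‖ ≤ ‖fourier (ω ^ 2) z‖) : ‖fourier ω z‖ ≤ 2 * ‖fourier 1 z‖ := by
  have hprod : ‖fourier ω z‖ * ‖fourier (ω ^ 2) z‖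
      ≤ ‖fourier 1 z‖ * ‖fourier ω z‖ + ‖fourier (ω ^ 2) z‖ * ‖fourier 1 z‖ := by
    have hshift : fourier ω z * conj (fourier (ω ^ 2) z)
        = -(fourier 1 z * conj (fourier ω z) + fourier (ω ^ 2) z * conj (fourier 1 z)) := by
      linear_combination fourier_shift_eq_zero hω hz
    calc ‖fourier ω z‖ * ‖fourier (ω ^ 2) z‖ = ‖fourier ω z * conj (fourier (ω ^ 2) z)‖ := by
          rw [norm_mul, RCLike.norm_conj]
      _ ≤ ‖fourier 1 z * conj (fourier ω z)‖ + ‖fourier (ω ^ 2) z * conj (fourier 1 z)‖ := by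
          rw [hshift, norm_neg]
          exact norm_add_le _ _
      _ = _ := by simp only [norm_mul, RCLike.norm_conj]
  rcases (norm_nonneg (fourier (ω ^ 2) z)).eq_or_lt with h0 | hpos
  · linarith [norm_nonneg (fourier 1 z)]
  · refine le_of_mul_le_mul_right ?_ hpos
    nlinarith [norm_nonneg (fourier 1 z)]

lemma coe_cubeRoot : (cubeRoot : ℂ) = ⟨-1 / 2, √3 / 2⟩ := by
  have h : 2 * Real.pi / 3 = Real.pi - Real.pi / 3 := by ring
  rw [cubeRoot, Circle.coe_exp, Complex.exp_mul_I, ← Complex.ofReal_cos, ← Complex.ofReal_sin, h,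
    Real.cos_pi_sub, Real.sin_pi_sub, Real.cos_pi_div_three, Real.sin_pi_div_three]
  apply Complex.ext <;> simp
  norm_num

lemma isPrimitiveRoot_cubeRoot : IsPrimitiveRoot (cubeRoot : ℂ) 3 := by
  convert Complex.isPrimitiveRoot_exp 3 (by norm_num) using 1
  rw [cubeRoot, Circle.coe_exp]
  push_cast
  ring_nf

lemma cross_sum_eq (z : Fin 3 → ℂ) :
    2 / (3 * √3) * (cross (z 0) (z 1) + cross (z 1) (z 2) + cross (z 2) (z 0))
      = (‖fourier ((cubeRoot : ℂ) ^ 2) z‖ ^ 2 - ‖fourier cubeRoot z‖ ^ 2) / 9 := by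
  have hre : (cubeRoot : ℂ).re = -1 / 2 := by rw [coe_cubeRoot]
  have him : (cubeRoot : ℂ).im = √3 / 2 := by rw [coe_cubeRoot]
  have hs : √3 ^ 2 = 3 := Real.sq_sqrt (by norm_num)
  have hω2 : (cubeRoot : ℂ) ^ 2 = -1 - cubeRoot := by
    linear_combination sq_add_self_add_one isPrimitiveRoot_cubeRoot
  have hω4 : ((cubeRoot : ℂ) ^ 2) ^ 2 = cubeRoot := by
    linear_combination (cubeRoot ^ 2 - cubeRoot : ℂ)
      * sq_add_self_add_one isPrimitiveRoot_cubeRoot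
  rw [fourier_eq, fourier_eq, hω4, hω2]
  simp only [Complex.sq_norm, Complex.normSq_apply, cross, Complex.add_re, Complex.add_im,
    Complex.sub_re, Complex.sub_im, Complex.neg_re, Complex.neg_im, Complex.one_re, Complex.one_im,
    Complex.mul_re, Complex.mul_im, hre, him]
  field_simp
  grind

end Fourier

/-! ### The deviation from the pure interface -/

/-- The quadratic deviation of three phases from each other. -/
def spread (v : Plane → Circle) (T : Triangle) : ℝ :=
  ∑ α, ‖(v (T.vertex α) : ℂ) - v (T.vertex (α + 1))‖ ^ 2

/-- The chirality of a field on the unit lattice in one triangle. -/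
def unitChirality (W : Plane → Circle) (T : Triangle) : ℝ :=
  2 / (3 * √3) * (cross (W (T.vertex 0)) (W (T.vertex 1)) + cross (W (T.vertex 1)) (W (T.vertex 2))
    + cross (W (T.vertex 2)) (W (T.vertex 0)))

/-- The triangles whose vertices lie on the same side of the interface. -/
def Triangle.IsOneSided (ν : Plane) (T : Triangle) : Prop :=
  ∀ α, jump ν (T.vertex α) = jump ν (T.vertex 0)

section Spread

variable {ν : Plane} {T : Triangle} {W v : Plane → Circle}

lemma jump_of_height_nonneg {x : Plane} (h : 0 ≤ height ν x) : jump ν x = 1 :=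
  if_pos (by rwa [real_inner_comm])

lemma jump_of_height_neg {x : Plane} (h : height ν x < 0) : jump ν x = -1 :=
  if_neg (by rwa [real_inner_comm, not_le])

lemma jump_eq_jump_iff {x y : Plane} :
    jump ν x = jump ν y ↔ (0 ≤ height ν x ↔ 0 ≤ height ν y) := by
  rcases le_or_gt 0 (height ν x) with hx | hx <;> rcases le_or_gt 0 (height ν y) with hy | hy <;>
    simp [jump_of_height_nonneg, jump_of_height_neg, hx, hy, not_le.2] <;> norm_num

lemma triangleChirality_eq {ε : ℝ} (u : SpinField ε) (T : Triangle) :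
    triangleChirality u T = unitChirality u.toUnit T := by
  simp only [triangleChirality, unitChirality, u.toUnit_vertex]

lemma sum_sq_norm_sub_add {a b c : ℂ} (ha : ‖a‖ = 1) (hb : ‖b‖ = 1) (hc : ‖c‖ = 1) :
    ‖a - b‖ ^ 2 + ‖b - c‖ ^ 2 + ‖c - a‖ ^ 2 + ‖a + b + c‖ ^ 2 = 9 := by
  have h {z : ℂ} (hz : ‖z‖ = 1) : z.re * z.re + z.im * z.im = 1 := by
    rw [← Complex.normSq_apply, ← Complex.sq_norm, hz, one_pow]
  simp only [Complex.sq_norm, Complex.normSq_apply, Complex.sub_re, Complex.sub_im, Complex.add_re,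
    Complex.add_im]
  linear_combination 3 * h ha + 3 * h hb + 3 * h hc

lemma spread_add_cost (v : Plane → Circle) (T : Triangle) : spread v T + cost v T = 9 := by
  simp only [spread, cost, Fin.sum_univ_three]
  exact sum_sq_norm_sub_add (Circle.norm_coe _) (Circle.norm_coe _) (Circle.norm_coe _)

lemma cost_eq_fourier_one (W : Plane → Circle) (T : Triangle) :
    cost W T = ‖fourier 1 fun α => W (T.vertex α)‖ ^ 2 := by
  simp [cost, fourier]

lemma spread_eq {ω : ℂ} (hω : IsPrimitiveRoot ω 3)
    (h : ∀ α : Fin 3, (W (T.vertex α) : ℂ) = v (T.vertex α) * ω ^ (α : ℕ)) :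
    spread v T = cost W T + ‖fourier ω fun α => W (T.vertex α)‖ ^ 2 := by
  have hv : cost v T = ‖fourier (ω ^ 2) fun α => W (T.vertex α)‖ ^ 2 := by
    have h3 : ω ^ 3 = 1 := hω.pow_eq_one
    simp only [cost, fourier_eq, Fin.sum_univ_three, h, Fin.coe_ofNat_eq_mod]
    congr 2
    grind
  have hp := parseval_three hω fun α => (W (T.vertex α) : ℂ)
  simp only [Circle.norm_coe, Fin.sum_univ_three] at hp
  rw [cost_eq_fourier_one W]
  linarith [spread_add_cost v T]

/-- In a triangle on one side of the interface, the interface runs through the powers of a primitive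
root `ω`, and the chirality has the sign of the interface if and only if the mode `ω ^ 2`, that of
the interface, dominates the mode `ω`. -/
lemma exists_interface_eq_pow (hT : T.IsOneSided ν) :
    ∃ ω : ℂ, IsPrimitiveRoot ω 3 ∧
      (∀ α : Fin 3, (interface ν (T.vertex α) : ℂ) = ω ^ (α : ℕ)) ∧
      ∀ W : Plane → Circle, jump ν (T.vertex 0) * unitChirality W T
        = (‖fourier (ω ^ 2) fun α => W (T.vertex α)‖ ^ 2
            - ‖fourier ω fun α => W (T.vertex α)‖ ^ 2) / 9 := by
  have hside (α : Fin 3) := jump_eq_jump_iff.1 (hT α)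
  rcases le_or_gt 0 (height ν (T.vertex 0)) with h0 | h0
  · refine ⟨cubeRoot, isPrimitiveRoot_cubeRoot, fun α => ?_, fun W => ?_⟩
    · rw [interface, if_pos ((hside α).2 h0), ground_vertex, Circle.coe_pow]
    · rw [jump_of_height_nonneg h0, one_mul]
      exact cross_sum_eq fun α => (W (T.vertex α) : ℂ)
  · refine ⟨(cubeRoot : ℂ) ^ 2, isPrimitiveRoot_cubeRoot.pow_of_coprime 2 (by norm_num),
      fun α => ?_, fun W => ?_⟩
    · rw [interface, if_neg (mt (hside α).1 h0.not_ge), ground_vertex, ← inv_pow, inv_cubeRoot,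
        Circle.coe_pow, Circle.coe_pow]
    · have hcube : ((cubeRoot : ℂ) ^ 2) ^ 2 = cubeRoot := by
        rw [← pow_mul, pow_succ, isPrimitiveRoot_cubeRoot.pow_eq_one, one_mul]
      have hcross := cross_sum_eq fun α => (W (T.vertex α) : ℂ)
      rw [jump_of_height_neg h0, hcube, unitChirality]
      linarith

lemma cost_le_spread (hT : T.IsOneSided ν)
    (h : ∀ α, W (T.vertex α) = v (T.vertex α) * interface ν (T.vertex α)) :
    cost W T ≤ spread v T := by
  obtain ⟨ω, hω, hinterface, -⟩ := exists_interface_eq_pow hT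
  rw [spread_eq (W := W) hω fun α => by rw [h, Circle.coe_mul, hinterface]]
  exact le_add_of_nonneg_right (sq_nonneg _)

lemma spread_le_cost (hT : T.IsOneSided ν)
    (h : ∀ α, W (T.vertex α) = v (T.vertex α) * interface ν (T.vertex α))
    (hχ : 0 ≤ jump ν (T.vertex 0) * unitChirality W T) : spread v T ≤ 5 * cost W T := by
  obtain ⟨ω, hω, hinterface, hchirality⟩ := exists_interface_eq_pow hT
  rw [hchirality] at hχ
  have hle := norm_fourier_le hω (fun α => Circle.norm_coe (W (T.vertex α)))
    ((sq_le_sq₀ (norm_nonneg _) (norm_nonneg _)).1 (by linarith))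
  rw [spread_eq (W := W) hω fun α => by rw [h, Circle.coe_mul, hinterface], cost_eq_fourier_one]
  nlinarith [norm_nonneg (fourier ω fun α => (W (T.vertex α) : ℂ))]

lemma cost_eq_zero (hT : T.IsOneSided ν)
    (h : ∀ α, W (T.vertex α) = interface ν (T.vertex α)) : cost W T = 0 := by
  refine le_antisymm ((cost_le_spread (v := 1) hT (by simpa using h)).trans ?_) (cost_nonneg W T)
  simp [spread]

end Spread

/-! ### Tiling the interface with copies of a field -/

/-- The translate of a triangle by a vector of the first sublattice. -/
def Triangle.shift (T : Triangle) (t : Plane) (ht : t ∈ sublattice 0) : Triangle where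
  vertex α := T.vertex α + t
  mem α := add_mem_sublattice (T.mem α) ht
  dist_eq α β h := by rw [dist_add_right, T.dist_eq α β h]

lemma Triangle.shift_injective {t : Plane} (ht : t ∈ sublattice 0) :
    Function.Injective fun T : Triangle => T.shift t ht := fun _ _ h =>
  Triangle.ext_vertex fun α => add_right_cancel (congrArg (fun T : Triangle => T.vertex α) h)

open Classical in
lemma interface_sub {ν p t : Plane} (ht : t ∈ sublattice 0)
    (h : 0 ≤ height ν (p - t) ↔ 0 ≤ height ν p) : interface ν (p - t) = interface ν p := by
  have hground : ground (p - t) = ground p := by rw [← ground_add ht, sub_add_cancel]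
  exact if_congr h hground (congrArg _ hground)

/-- The vectors `S` of the first sublattice translate `box ν R` to disjoint copies in `box ν L`,
lined up along the interface with bounded gaps. -/
structure IsPacking (ν : Plane) (R L : ℝ) (S : Finset Plane) : Prop where
  mem_sublattice : ∀ t ∈ S, t ∈ sublattice 0
  abs_height_le : ∀ t ∈ S, |height ν t| ≤ 2
  abs_along_add_le : ∀ t ∈ S, |along ν t| + R ≤ L - 4
  separated : ∀ t ∈ S, ∀ t' ∈ S, t ≠ t' → 2 * R ≤ |along ν t - along ν t'|
  card_mul_le : S.card * (2 * R + 12) ≤ 2 * L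
  lt_card_mul : 2 * L < (S.card + 1) * (2 * R + 12)

/-- The triangle lies in none of the translates of the box by the vectors in `S`. -/
def Triangle.IsGap (ν : Plane) (R : ℝ) (S : Finset Plane) (T : Triangle) : Prop :=
  ∀ t ∈ S, ∃ β, T.vertex β - t ∉ box ν R

open Classical in
/-- Copies of a field in the translates of a box, surrounded by the pure interface. The copy at a
point is chosen arbitrarily if the translates overlap. -/
def tiling (ν : Plane) (R : ℝ) (S : Finset Plane) (W : Plane → Circle) (p : Plane) : Circle :=
  if h : ∃ t ∈ S, p - t ∈ box ν R then W (p - h.choose) else interface ν p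

/-- A closed rectangle around the interface. -/
def slab (ν : Plane) (h a b : ℝ) : Set Plane :=
  {x | along ν x ∈ Set.Icc a b ∧ height ν x ∈ Set.Icc (-h) h}

/-- The centre of the `k`-th cell in the partition of `[-L, L]` into cells of length `P`. -/
def cellCenter (L P : ℝ) (k : ℕ) : ℝ := -L + (k + 1 / 2) * P

section Tiling

lemma nonneg_iff_of_abs_sub_lt {a b : ℝ} (h : |a - b| < |b|) : 0 ≤ a ↔ 0 ≤ b := by
  rw [abs_lt] at h
  rcases abs_cases b with hb | hb
  · exact iff_of_true (by linarith) hb.2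
  · exact iff_of_false (by linarith) hb.2.not_ge

variable {ν : Plane} {R L : ℝ} {S : Finset Plane} {W : Plane → Circle}

lemma measurableSet_slab (ν : Plane) (h a b : ℝ) : MeasurableSet (slab ν h a b) :=
  (measurableSet_Icc.preimage (along ν).continuous.measurable).inter
    (measurableSet_Icc.preimage (height ν).continuous.measurable)

lemma volume_slab (hν : ‖ν‖ = 1) {h : ℝ} (hh : 0 ≤ h) (a b : ℝ) :
    volume (slab ν h a b) = ENNReal.ofReal (2 * h * (b - a)) := by
  rw [slab, volume_along_height_Icc hν, sub_neg_eq_add, ← two_mul, mul_comm,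
    ENNReal.ofReal_mul (p := 2 * h) (by positivity)]

lemma le_abs_cellCenter_sub {P : ℝ} (hP : 0 ≤ P) (L : ℝ) {j k : ℕ} (hjk : j ≠ k) :
    P ≤ |cellCenter L P j - cellCenter L P k| := by
  have h1 : (1 : ℝ) ≤ |(j : ℝ) - k| := by
    exact_mod_cast Int.one_le_abs (sub_ne_zero.2 (Nat.cast_injective.ne hjk : (j : ℤ) ≠ k))
  have h : cellCenter L P j - cellCenter L P k = (j - k) * P := by
    simp only [cellCenter]
    ring
  rw [h, abs_mul, abs_of_nonneg hP]
  exact le_mul_of_one_le_left hP h1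

lemma abs_cellCenter_le {P : ℝ} (hP : 0 ≤ P) {k n : ℕ} (hk : k < n) (hn : n * P ≤ 2 * L) :
    |cellCenter L P k| ≤ L - P / 2 := by
  have h0 : 0 ≤ (k : ℝ) * P := by positivity
  have h1 : ((k : ℝ) + 1) * P ≤ n * P := by
    gcongr
    exact_mod_cast hk
  rw [abs_le, cellCenter]
  constructor <;> linarith

lemma exists_isPacking (hν : ‖ν‖ = 1) (hR : 0 < R) (hL : 0 ≤ L) : ∃ S, IsPacking ν R L S := by
  have hP : 0 < 2 * R + 12 := by linarith
  let n := ⌊2 * L / (2 * R + 12)⌋₊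
  let c := cellCenter L (2 * R + 12)
  have hn : n * (2 * R + 12) ≤ 2 * L := (le_div_iff₀ hP).1 (Nat.floor_le (by positivity))
  choose t ht htd using fun k => exists_mem_sublattice_zero_dist_le (c k • perp ν)
  have halong (k : ℕ) : |along ν (t k) - c k| ≤ 2 := by
    simpa [along_perp hν] using (abs_along_sub_le hν _ _).trans (htd k)
  have hheight (k : ℕ) : |height ν (t k)| ≤ 2 := by
    simpa [height_perp] using (abs_height_sub_le hν _ _).trans (htd k)
  have hsep {j k : ℕ} (hjk : j ≠ k) : 2 * R ≤ |along ν (t j) - along ν (t k)| := by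
    have h1 : _ ≤ |c j - c k| := le_abs_cellCenter_sub hP.le L hjk
    have h2 := abs_sub_le (c j) (along ν (t j)) (c k)
    have h3 := abs_sub_le (along ν (t j)) (along ν (t k)) (c k)
    rw [abs_sub_comm (c j) (along ν (t j))] at h2
    linarith [halong j, halong k]
  have hinj : Function.Injective t := fun j k h => by
    by_contra hjk
    have := hsep hjk
    rw [h, sub_self, abs_zero] at this
    linarith
  refine ⟨(Finset.range n).map ⟨t, hinj⟩, ?_, ?_, ?_, ?_, ?_, ?_⟩
  all_goals simp only [Finset.forall_mem_map, Finset.card_map, Finset.card_range,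
    Function.Embedding.coeFn_mk, Finset.mem_range]
  · exact fun k _ => ht k
  · exact fun k _ => hheight k
  · intro k hk
    have h1 := abs_cellCenter_le hP.le hk hn
    linarith [abs_sub_abs_le_abs_sub (along ν (t k)) (c k), halong k]
  · exact fun j _ k _ hjk => hsep (ne_of_apply_ne t hjk)
  · exact hn
  · exact (div_lt_iff₀ hP).1 (Nat.lt_floor_add_one _)

namespace IsPacking

variable (hS : IsPacking ν R L S)
include hS

lemma eq_of_sub_mem_box {t t' p : Plane} (ht : t ∈ S) (ht' : t' ∈ S) (hp : p - t ∈ box ν R)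
    (hp' : p - t' ∈ box ν R) : t = t' := by
  by_contra hne
  have h := hS.separated t ht t' ht' hne
  have h1 := hp.1
  have h2 := hp'.1
  rw [map_sub] at h1 h2
  rw [abs_sub_comm] at h1
  linarith [abs_sub_le (along ν t) (along ν p) (along ν t')]

lemma tiling_of_mem {t p : Plane} (ht : t ∈ S) (hp : p - t ∈ box ν R) :
    tiling ν R S W p = W (p - t) := by
  have h : ∃ t ∈ S, p - t ∈ box ν R := ⟨t, ht, hp⟩
  rw [tiling, dif_pos h, hS.eq_of_sub_mem_box h.choose_spec.1 ht h.choose_spec.2 hp]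

lemma tiling_eq_interface {p : Plane} (hR : 0 ≤ R) (hp : p ∉ box ν (L - 4)) :
    tiling ν R S W p = interface ν p := by
  refine dif_neg fun ⟨t, ht, h⟩ => hp ?_
  have hcard : (1 : ℝ) ≤ S.card := by exact_mod_cast Finset.card_pos.2 ⟨t, ht⟩
  have halong := (abs_sub_abs_le_abs_sub (along ν p) (along ν t)).trans_lt
    (map_sub (along ν) p t ▸ h.1)
  have hheight := (abs_sub_abs_le_abs_sub (height ν p) (height ν t)).trans_lt
    (map_sub (height ν) p t ▸ h.2)
  have hRL : 2 * R + 12 ≤ 2 * L := (le_mul_of_one_le_left (by linarith) hcard).trans hS.card_mul_le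
  exact ⟨by linarith [hS.abs_along_add_le t ht], by linarith [hS.abs_height_le t ht]⟩

/-- Above and below the interface, the boundary condition matches the copies with the ground state
between them. -/
lemma cost_tiling_eq_zero (hν : ‖ν‖ = 1) (hW : IsClamped ν R W) {T : Triangle}
    (hT : T.IsGap ν R S) (hh : 6 < |height ν (T.vertex 0)|) : cost (tiling ν R S W) T = 0 := by
  have hdist (α : Fin 3) : |height ν (T.vertex α) - height ν (T.vertex 0)| ≤ 1 :=
    (abs_height_sub_le hν _ _).trans (T.dist_le _ _)
  refine cost_eq_zero (ν := ν) (fun α => jump_eq_jump_iff.2 ?_) fun α => ?_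
  · exact nonneg_iff_of_abs_sub_lt ((hdist α).trans_lt (by linarith))
  rw [tiling]
  split_ifs with h
  · obtain ⟨ht, hmem⟩ := h.choose_spec
    have hsublattice := hS.mem_sublattice _ ht
    obtain ⟨β, hβ⟩ := hT _ ht
    have hlattice : T.vertex α - h.choose ∈ lattice := by
      rw [sub_eq_add_neg]
      exact sublattice_subset α (add_mem_sublattice (T.mem α)
        (neg_mem_sublattice_zero hsublattice))
    have h5 := abs_sub_abs_le_abs_sub (height ν (T.vertex 0)) (height ν (T.vertex α))
    have h3 := abs_sub_abs_le_abs_sub (height ν (T.vertex α)) (height ν h.choose)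
    have h2 := hS.abs_height_le _ ht
    rw [abs_sub_comm] at h5
    rw [← map_sub] at h3
    rw [hW hlattice hmem hβ (by rw [dist_sub_right]; exact T.dist_le α β)
        (by linarith [hdist α]), interface_sub hsublattice]
    refine nonneg_iff_of_abs_sub_lt ?_
    rw [map_sub, sub_sub_cancel_left, abs_neg]
    linarith [hdist α]
  · rfl

lemma sum_copy_le (hν : ‖ν‖ = 1) (W : Plane → Circle) {t : Plane} (ht : t ∈ S)
    {F : Finset Triangle} (hF : ∀ T ∈ F, ∀ α, T.vertex α - t ∈ box ν R) :
    ∑ T ∈ F, cost (tiling ν R S W) T ≤ ∑ T ∈ triF ν R, cost W T := by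
  have hneg := neg_mem_sublattice_zero (hS.mem_sublattice t ht)
  calc ∑ T ∈ F, cost (tiling ν R S W) T = ∑ T ∈ F, cost W (T.shift (-t) hneg) :=
        Finset.sum_congr rfl fun T hT => cost_congr fun α => by
          rw [hS.tiling_of_mem ht (hF T hT α), sub_eq_add_neg, Triangle.shift]
    _ = ∑ T ∈ F.map ⟨_, Triangle.shift_injective hneg⟩, cost W T := by
        rw [Finset.sum_map, Function.Embedding.coeFn_mk]
    _ ≤ ∑ T ∈ triF ν R, cost W T := by
        refine Finset.sum_le_sum_of_subset_of_nonneg ?_ fun T _ _ => cost_nonneg _ _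
        intro T hT
        obtain ⟨T', hT', rfl⟩ := Finset.mem_map.1 hT
        refine (mem_triF hν).2 fun α => ?_
        have h := hF T' hT' α
        rwa [sub_eq_add_neg] at h

lemma volume_slab_sdiff_le (hν : ‖ν‖ = 1) (hR : 10 < R) :
    volume (slab ν 7 (-L - 1) (L + 1) \
        ⋃ t ∈ S, slab ν 7 (along ν t - (R - 2)) (along ν t + (R - 2))) ≤
      ENNReal.ofReal (14 * (16 * S.card + 2 * R + 14)) := by
  let copy (t : Plane) := slab ν 7 (along ν t - (R - 2)) (along ν t + (R - 2))
  have hcopy {t x : Plane} (ht : t ∈ S) (hx : x ∈ copy t) : x - t ∈ box ν R := by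
    have h1 := hx.1
    have h2 := hx.2
    have h3 := abs_le.1 (hS.abs_height_le t ht)
    simp only [Set.mem_Icc] at h1 h2
    exact ⟨by rw [map_sub, abs_lt]; constructor <;> linarith,
      by rw [map_sub, abs_lt]; constructor <;> linarith⟩
  have hdisj : (S : Set Plane).PairwiseDisjoint copy := fun t ht t' ht' hne =>
    Set.disjoint_left.2 fun x hx hx' =>
      hne (hS.eq_of_sub_mem_box ht ht' (hcopy ht hx) (hcopy ht' hx'))
  have hsub : (⋃ t ∈ S, copy t) ⊆ slab ν 7 (-L - 1) (L + 1) := by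
    refine Set.iUnion₂_subset fun t ht x hx => ⟨?_, hx.2⟩
    have h := hS.abs_along_add_le t ht
    have h1 := hx.1
    simp only [Set.mem_Icc] at h1 ⊢
    constructor <;> linarith [neg_abs_le (along ν t), le_abs_self (along ν t)]
  have hmeas : MeasurableSet (⋃ t ∈ S, copy t) :=
    S.measurableSet_biUnion fun t _ => measurableSet_slab _ _ _ _
  have hvol : volume (⋃ t ∈ S, copy t) = ENNReal.ofReal (S.card * (2 * 7 * (2 * R - 4))) := by
    rw [measure_biUnion_finset hdisj fun t _ => measurableSet_slab _ _ _ _]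
    have hlength (t : Plane) : along ν t + (R - 2) - (along ν t - (R - 2)) = 2 * R - 4 := by ring
    simp only [copy, volume_slab hν (h := 7) (by norm_num), hlength, Finset.sum_const, nsmul_eq_mul]
    rw [ENNReal.ofReal_mul (Nat.cast_nonneg _), ENNReal.ofReal_natCast]
  rw [measure_sdiff hsub hmeas.nullMeasurableSet (by rw [hvol]; exact ENNReal.ofReal_ne_top), hvol,
    volume_slab hν (by norm_num), ← ENNReal.ofReal_sub _ (by nlinarith)]
  apply ENNReal.ofReal_le_ofReal
  linarith [hS.lt_card_mul]

lemma card_gap_le (hν : ‖ν‖ = 1) (hR : 10 < R) {G : Finset Triangle}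
    (hG : ∀ T ∈ G, T.IsGap ν R S ∧ T.vertex 0 ∈ box ν L ∧ |height ν (T.vertex 0)| ≤ 6) :
    (G.card : ℝ) ≤ 168 * (16 * S.card + 2 * R + 14) := by
  have hball : ∀ T ∈ G, Metric.ball (T.center 1) (1 / 6) ⊆ slab ν 7 (-L - 1) (L + 1) \
      ⋃ t ∈ S, slab ν 7 (along ν t - (R - 2)) (along ν t + (R - 2)) := by
    intro T hT x hx
    obtain ⟨hgap, hbox, hh⟩ := hG T hT
    have hdist (α : Fin 3) : dist x (T.vertex α) ≤ 1 :=
      T.dist_vertex_le_one (T.ball_subset_hull one_pos hx) α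
    have ha (α : Fin 3) := abs_le.1 ((abs_along_sub_le hν _ _).trans (hdist α))
    have hb (α : Fin 3) := abs_le.1 ((abs_height_sub_le hν _ _).trans (hdist α))
    have hx0 := abs_lt.1 hbox.1
    rw [abs_le] at hh
    refine ⟨⟨⟨by linarith [ha 0], by linarith [ha 0]⟩, by linarith [hb 0], by linarith [hb 0]⟩, ?_⟩
    simp only [Set.mem_iUnion, not_exists]
    rintro t ht ⟨⟨h1, h2⟩, h3, h4⟩
    obtain ⟨β, hβ⟩ := hgap t ht
    have h5 := abs_le.1 (hS.abs_height_le t ht)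
    refine hβ ⟨?_, ?_⟩ <;> rw [map_sub, abs_lt]
    · constructor <;> linarith [ha β]
    · constructor <;> linarith [hb β]
  have h := (card_mul_le_volume_of_ball_subset one_pos G hball).trans
    (hS.volume_slab_sdiff_le hν hR)
  rw [ENNReal.ofReal_le_ofReal_iff (by positivity)] at h
  linarith

open Classical in
lemma sum_tiling_le (hν : ‖ν‖ = 1) (hR : 10 < R) (hW : IsClamped ν R W) :
    ∑ T ∈ triF ν L, cost (tiling ν R S W) T
      ≤ S.card * ∑ T ∈ triF ν R, cost W T + 1512 * (16 * S.card + 2 * R + 14) := by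
  let c := cost (tiling ν R S W)
  let inCopy (t : Plane) := (triF ν L).filter fun T => ∀ α, T.vertex α - t ∈ box ν R
  let gap := (triF ν L).filter fun T => T.IsGap ν R S ∧ |height ν (T.vertex 0)| ≤ 6
  have hcover (T : Triangle) (hT : T ∈ triF ν L) (hc : c T ≠ 0) : T ∈ S.biUnion inCopy ∪ gap := by
    by_cases hgap : T.IsGap ν R S
    · have hh := not_lt.1 (mt (hS.cost_tiling_eq_zero hν hW hgap) hc)
      exact Finset.mem_union_right _ (Finset.mem_filter.2 ⟨hT, hgap, hh⟩)
    · simp only [Triangle.IsGap, not_forall, not_exists, not_not] at hgap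
      obtain ⟨t, ht, hmem⟩ := hgap
      exact Finset.mem_union_left _ (Finset.mem_biUnion.2 ⟨t, ht, Finset.mem_filter.2 ⟨hT, hmem⟩⟩)
  have hdisj : (S : Set Plane).PairwiseDisjoint inCopy := fun t ht t' ht' hne =>
    Finset.disjoint_left.2 fun T hT hT' => hne (hS.eq_of_sub_mem_box ht ht'
      ((Finset.mem_filter.1 hT).2 0) ((Finset.mem_filter.1 hT').2 0))
  have hsum_copies : ∑ T ∈ S.biUnion inCopy, c T ≤ S.card * ∑ T ∈ triF ν R, cost W T := by
    rw [Finset.sum_biUnion hdisj, ← nsmul_eq_mul]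
    exact Finset.sum_le_card_nsmul _ _ _ fun t ht =>
      hS.sum_copy_le hν W ht fun T hT => (Finset.mem_filter.1 hT).2
  have hsum_gap : ∑ T ∈ gap, c T ≤ gap.card * 9 := by
    rw [← nsmul_eq_mul]
    exact Finset.sum_le_card_nsmul _ _ _ fun T _ => cost_le _ T
  have hcard : (gap.card : ℝ) ≤ 168 * (16 * S.card + 2 * R + 14) :=
    hS.card_gap_le hν hR fun T hT => by
      obtain ⟨hT, hgap, hh⟩ := Finset.mem_filter.1 hT
      exact ⟨hgap, (mem_triF hν).1 hT 0, hh⟩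
  calc ∑ T ∈ triF ν L, c T = ∑ T ∈ triF ν L with c T ≠ 0, c T := (Finset.sum_filter_ne_zero _).symm
    _ ≤ ∑ T ∈ S.biUnion inCopy ∪ gap, c T :=
        Finset.sum_le_sum_of_subset_of_nonneg
          (fun T hT => hcover T (Finset.mem_filter.1 hT).1 (Finset.mem_filter.1 hT).2)
          fun T _ _ => cost_nonneg _ T
    _ ≤ ∑ T ∈ S.biUnion inCopy, c T + ∑ T ∈ gap, c T := by
        rw [← Finset.sum_union_inter]
        exact le_add_of_nonneg_right (Finset.sum_nonneg fun T _ => cost_nonneg _ T)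
    _ ≤ S.card * ∑ T ∈ triF ν R, cost W T + 1512 * (16 * S.card + 2 * R + 14) := by linarith

end IsPacking

end Tiling

section CellMin

variable {ν : Plane}

lemma cellMin_le_energy {ε : ℝ} {u : SpinField ε} (hu : u ∈ admissible ε ν) :
    cellMin ε ν ≤ energy u (square ν) :=
  iInf₂_le u hu

lemma cellMin_le_ofReal (hν : ‖ν‖ = 1) {ε : ℝ} (hε : 0 < ε) {W : Plane → Circle}
    (hW : ∀ p ∉ box ν (1 / 2 / ε - 4), 3 ≤ |height ν p| → W p = interface ν p) :
    cellMin ε ν ≤ ENNReal.ofReal (ε * ∑ T ∈ triF ν (1 / 2 / ε), cost W T) := by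
  refine (cellMin_le_energy (ofUnit_mem_admissible hν hε hW)).trans_eq ?_
  simp only [energy_square_eq hν hε, SpinField.cost_toUnit_ofUnit hε]

lemma cellMin_le_add (hν : ‖ν‖ = 1) {ε η : ℝ} (hε : 0 < ε) (hε' : ε ≤ 1 / 40) (hη : 0 < η) :
    cellMin η ν ≤ cellMin ε ν + ENNReal.ofReal (25000 * (ε + η / ε)) := by
  rw [← tsub_le_iff_right]
  refine le_iInf₂ fun u hu => ?_
  rw [tsub_le_iff_right]
  have hR : 10 < 1 / 2 / ε := by
    rw [lt_div_iff₀ hε]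
    linarith
  obtain ⟨S, hS⟩ :=
    exists_isPacking hν (L := 1 / 2 / η) (by linarith : 0 < 1 / 2 / ε) (by positivity)
  have hsum := hS.sum_tiling_le hν hR (isClamped_toUnit hε hu)
  let E := ∑ T ∈ triF ν (1 / 2 / ε), cost u.toUnit T
  have hE : 0 ≤ E := Finset.sum_nonneg fun T _ => cost_nonneg _ T
  have hcard : η * S.card ≤ ε := by
    have h := hS.card_mul_le
    have hS0 : (0 : ℝ) ≤ S.card := Nat.cast_nonneg _
    have h1 : 2 * (1 / 2 / η) = 1 / η := by ring
    have h2 : (S.card : ℝ) * (1 / ε) ≤ 1 / η := by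
      refine le_trans ?_ (h.trans_eq h1)
      gcongr
      linarith [show 2 * (1 / 2 / ε) = 1 / ε by ring]
    rw [mul_one_div, div_le_div_iff₀ hε hη] at h2
    linarith
  calc cellMin η ν
      ≤ ENNReal.ofReal (η * ∑ T ∈ triF ν (1 / 2 / η), cost (tiling ν (1 / 2 / ε) S u.toUnit) T) :=
        cellMin_le_ofReal hν hη fun p hp _ => hS.tiling_eq_interface (by positivity) hp
    _ ≤ ENNReal.ofReal (ε * E + 25000 * (ε + η / ε)) := by
        apply ENNReal.ofReal_le_ofReal
        have hηε : η ≤ η / ε := le_div_self hη.le hε (by linarith)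
        calc _ ≤ η * (S.card * E + 1512 * (16 * S.card + 2 * (1 / 2 / ε) + 14)) := by gcongr
          _ = η * S.card * E + 1512 * (16 * (η * S.card) + η / ε + 14 * η) := by ring
          _ ≤ ε * E + 1512 * (16 * ε + η / ε + 14 * (η / ε)) := by gcongr
          _ ≤ ε * E + 25000 * (ε + η / ε) := by linarith [div_pos hη hε]
    _ = energy u (square ν) + ENNReal.ofReal (25000 * (ε + η / ε)) := by
        rw [energy_square_eq hν hε, ENNReal.ofReal_add (mul_nonneg hε.le hE) (by positivity)]

lemma limsup_cellMin_le (hν : ‖ν‖ = 1) {ε : ℝ} (hε : 0 < ε) (hε' : ε ≤ 1 / 40) :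
    limsup (fun η => cellMin η ν) (𝓝[>] 0) ≤ cellMin ε ν + ENNReal.ofReal (25000 * ε) := by
  have hlim : Tendsto (fun η => 25000 * (ε + η / ε)) (𝓝[>] 0) (𝓝 (25000 * ε)) := by
    have h : Continuous fun η : ℝ => 25000 * (ε + η / ε) := by fun_prop
    simpa using (h.tendsto 0).mono_left nhdsWithin_le_nhds
  calc limsup (fun η => cellMin η ν) (𝓝[>] 0)
      ≤ limsup (fun η => cellMin ε ν + ENNReal.ofReal (25000 * (ε + η / ε))) (𝓝[>] 0) :=
        limsup_le_limsup (eventually_nhdsWithin_of_forall fun η hη => cellMin_le_add hν hε hε' hη)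
    _ = cellMin ε ν + ENNReal.ofReal (25000 * ε) :=
        ((ENNReal.tendsto_ofReal hlim).const_add _).limsup_eq

lemma limsup_cellMin_le_liminf (hν : ‖ν‖ = 1) :
    limsup (fun η => cellMin η ν) (𝓝[>] 0) ≤ liminf (fun η => cellMin η ν) (𝓝[>] 0) := by
  have hlim : Tendsto (fun ε : ℝ => ENNReal.ofReal (25000 * ε)) (𝓝[>] 0) (𝓝 0) := by
    have h : Continuous fun ε : ℝ => ENNReal.ofReal (25000 * ε) :=
      ENNReal.continuous_ofReal.comp (continuous_const_mul 25000)
    simpa using (h.tendsto 0).mono_left nhdsWithin_le_nhds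
  have hliminf := ENNReal.liminf_add_of_right_tendsto_zero hlim fun η => cellMin η ν
  rw [← hliminf]
  refine le_liminf_of_le (by isBoundedDefault) ?_
  filter_upwards [Ioo_mem_nhdsGT (show (0 : ℝ) < 1 / 40 by norm_num)] with ε hε
  exact limsup_cellMin_le hν hε.1 hε.2.le

lemma tendsto_cellMin (hν : ‖ν‖ = 1) :
    Tendsto (fun ε => cellMin ε ν) (𝓝[>] (0 : ℝ)) (𝓝 (phi ν)) := by
  have h := tendsto_of_le_liminf_of_limsup_le le_rfl (limsup_cellMin_le_liminf hν)
  rwa [phi, h.limUnder_eq]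

lemma phi_lt_top (hν : ‖ν‖ = 1) : phi ν < ⊤ := by
  have hcell : cellMin (1 / 40) ν < ⊤ :=
    (cellMin_le_ofReal hν (by norm_num) fun _ _ _ => rfl).trans_lt ENNReal.ofReal_lt_top
  rw [← (tendsto_cellMin hν).limsup_eq]
  exact (limsup_cellMin_le hν (by norm_num) le_rfl).trans_lt
    (ENNReal.add_lt_top.2 ⟨hcell, ENNReal.ofReal_lt_top⟩)

end CellMin

/-! ### Angles with a movable cut -/

open Classical in
/-- The angle of a unit vector, normalized to jump only at the angle `φ`, for `φ ∈ (-π, π]`. -/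
def cutArg (φ : ℝ) (z : Circle) : ℝ :=
  Complex.arg z + if Complex.arg z < φ then 2 * Real.pi else 0

/-- The quadratic deviation of the angles of a field on the edges of a triangle. -/
def cutSpread (φ : ℝ) (v : Plane → Circle) (T : Triangle) : ℝ :=
  ∑ α, (cutArg φ (v (T.vertex α)) - cutArg φ (v (T.vertex (α + 1)))) ^ 2

lemma exp_cutArg (φ : ℝ) (z : Circle) : Circle.exp (cutArg φ z) = z := by
  rw [cutArg]
  split_ifs
  · rw [Circle.exp_add, Circle.exp_arg, Circle.exp_two_pi, mul_one]
  · rw [add_zero, Circle.exp_arg]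

lemma abs_cutArg_le (φ : ℝ) (z : Circle) : |cutArg φ z| ≤ 3 * Real.pi := by
  have h1 := Complex.neg_pi_lt_arg z
  have h2 := Complex.arg_le_pi z
  rw [cutArg, abs_le]
  split_ifs <;> constructor <;> linarith

lemma norm_exp_sub_exp (x y : ℝ) :
    ‖(Circle.exp x : ℂ) - Circle.exp y‖ = 2 * |Real.sin ((x - y) / 2)| := by
  have h : (Circle.exp x : ℂ) - Circle.exp y =
      Circle.exp y * (Complex.exp (Complex.I * (x - y : ℝ)) - 1) := by
    rw [Circle.coe_exp, Circle.coe_exp, mul_sub, mul_one, ← Complex.exp_add]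
    congr 2
    push_cast
    ring
  rw [h, norm_mul, Circle.norm_coe, one_mul, Complex.norm_exp_I_mul_ofReal_sub_one, norm_mul,
    Real.norm_ofNat, Real.norm_eq_abs]

lemma norm_exp_sub_exp_le (x y : ℝ) : ‖(Circle.exp x : ℂ) - Circle.exp y‖ ≤ |x - y| := by
  have h := Real.abs_sin_le_abs (x := (x - y) / 2)
  rw [abs_div, abs_two] at h
  rw [norm_exp_sub_exp]
  linarith

lemma two_mul_mul_pi_sub_le_sin {x : ℝ} (h0 : 0 ≤ x) (h1 : x ≤ Real.pi) :
    2 * x * (Real.pi - x) ≤ Real.pi ^ 2 * Real.sin x := by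
  wlog h : x ≤ Real.pi / 2 generalizing x
  · have h' := this (x := Real.pi - x) (by linarith) (by linarith) (by linarith)
    rw [Real.sin_pi_sub] at h'
    linarith
  calc 2 * x * (Real.pi - x) ≤ 2 * x * Real.pi := by
        gcongr
        linarith
    _ = Real.pi ^ 2 * (2 / Real.pi * x) := by field_simp
    _ ≤ Real.pi ^ 2 * Real.sin x := by
        gcongr
        exact Real.mul_le_sin h0 h

lemma abs_arg_sub_mul_le (z w : Circle) :
    |Complex.arg z - Complex.arg w| * (2 * Real.pi - |Complex.arg z - Complex.arg w|) ≤
      10 * ‖(z : ℂ) - w‖ := by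
  let d := |Complex.arg z - Complex.arg w| / 2
  have hd0 : 0 ≤ d := by positivity
  have hd1 : d ≤ Real.pi := by
    rw [div_le_iff₀ two_pos, abs_le]
    constructor <;> linarith [Complex.neg_pi_lt_arg z, Complex.arg_le_pi z,
      Complex.neg_pi_lt_arg w, Complex.arg_le_pi w]
  have hsin : 0 ≤ Real.sin d := Real.sin_nonneg_of_nonneg_of_le_pi hd0 hd1
  have hnorm : ‖(z : ℂ) - w‖ = 2 * Real.sin d := by
    conv_lhs => rw [← Circle.exp_arg z, ← Circle.exp_arg w]
    rw [norm_exp_sub_exp, Real.abs_sin_eq_sin_abs_of_abs_le_pi, abs_div, abs_two]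
    rwa [abs_div, abs_two]
  have hpi : Real.pi ^ 2 ≤ 10 := by nlinarith [Real.pi_lt_d2, Real.pi_pos]
  calc _ = 2 * (2 * d * (Real.pi - d)) := by
        simp only [d]
        ring
    _ ≤ 2 * (10 * Real.sin d) := by
        have h : Real.pi ^ 2 * Real.sin d ≤ 10 * Real.sin d := by gcongr
        linarith [two_mul_mul_pi_sub_le_sin hd0 hd1]
    _ = 10 * ‖(z : ℂ) - w‖ := by
        rw [hnorm]
        ring

lemma sq_cutArg_sub (z w : Circle) (φ : ℝ) :
    (cutArg φ z - cutArg φ w) ^ 2 = |Complex.arg z - Complex.arg w| ^ 2 +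
      (Set.uIoc (Complex.arg z) (Complex.arg w)).indicator
        (fun _ => 4 * Real.pi * (Real.pi - |Complex.arg z - Complex.arg w|)) φ := by
  wlog h : Complex.arg z ≤ Complex.arg w generalizing z w
  · rw [sub_sq_comm, this w z (le_of_not_ge h), Set.uIoc_comm, abs_sub_comm]
  rw [cutArg, cutArg, Set.uIoc_of_le h, Set.indicator_apply, abs_of_nonpos (sub_nonpos.2 h)]
  simp only [Set.mem_Ioc]
  split_ifs <;> first | ring1 | (exfalso; grind)

lemma integrableOn_sq_cutArg_sub (z w : Circle) :
    IntegrableOn (fun φ => (cutArg φ z - cutArg φ w) ^ 2) (Set.Ioc (-Real.pi) Real.pi) := by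
  simp only [sq_cutArg_sub]
  exact (integrableOn_const measure_Ioc_lt_top.ne).add
    ((integrableOn_const measure_Ioc_lt_top.ne).indicator measurableSet_uIoc)

lemma integral_sq_cutArg_sub_le (z w : Circle) :
    ∫ φ in Set.Ioc (-Real.pi) Real.pi, (cutArg φ z - cutArg φ w) ^ 2 ≤
      2 * Real.pi * (10 * ‖(z : ℂ) - w‖) := by
  let d := |Complex.arg z - Complex.arg w|
  have hsub : Set.uIoc (Complex.arg z) (Complex.arg w) ⊆ Set.Ioc (-Real.pi) Real.pi :=
    Set.Ioc_subset_Ioc (le_min (Complex.neg_pi_lt_arg z).le (Complex.neg_pi_lt_arg w).le)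
      (max_le (Complex.arg_le_pi z) (Complex.arg_le_pi w))
  have hvol : volume.real (Set.uIoc (Complex.arg z) (Complex.arg w)) = d := by
    rw [measureReal_def, Real.volume_uIoc, ENNReal.toReal_ofReal (abs_nonneg _), abs_sub_comm]
  calc _ = ∫ φ in Set.Ioc (-Real.pi) Real.pi, (d ^ 2 +
          (Set.uIoc (Complex.arg z) (Complex.arg w)).indicator
            (fun _ => 4 * Real.pi * (Real.pi - d)) φ) := by simp only [sq_cutArg_sub, d]
    _ = 2 * Real.pi * (d * (2 * Real.pi - d)) := by
        have hindicator : IntegrableOn (Set.indicator (Set.uIoc (Complex.arg z) (Complex.arg w))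
            fun _ => 4 * Real.pi * (Real.pi - d)) (Set.Ioc (-Real.pi) Real.pi) :=
          (integrableOn_const measure_Ioc_lt_top.ne).indicator measurableSet_uIoc
        rw [integral_add (integrable_const _) hindicator,
          setIntegral_indicator measurableSet_uIoc, Set.inter_eq_self_of_subset_right hsub,
          setIntegral_const, setIntegral_const, hvol,
          Real.volume_real_Ioc_of_le (by linarith [Real.pi_pos]), smul_eq_mul, smul_eq_mul]
        ring
    _ ≤ 2 * Real.pi * (10 * ‖(z : ℂ) - w‖) := by
        gcongr ?_ * ?_
        exact abs_arg_sub_mul_le z w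

lemma le_inv_sq_add {K : ℝ} (hK : 0 < K) (d : ℝ) : d ≤ 1 / K ^ 2 + K ^ 2 * d ^ 2 := by
  have h : 1 / K ^ 2 + K ^ 2 * d ^ 2 - d = (1 / K - K * d / 2) ^ 2 + 3 / 4 * (K * d) ^ 2 := by
    field_simp
    ring
  linarith [sq_nonneg (1 / K - K * d / 2), sq_nonneg (K * d)]

lemma integrableOn_cutSpread (v : Plane → Circle) (T : Triangle) :
    IntegrableOn (fun φ => cutSpread φ v T) (Set.Ioc (-Real.pi) Real.pi) :=
  integrable_finsetSum _ fun _ _ => integrableOn_sq_cutArg_sub _ _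

lemma integral_cutSpread_le (v : Plane → Circle) (T : Triangle) {K : ℝ} (hK : 0 < K) :
    ∫ φ in Set.Ioc (-Real.pi) Real.pi, cutSpread φ v T ≤
      2 * Real.pi * (30 / K ^ 2 + 10 * K ^ 2 * spread v T) := by
  simp only [cutSpread]
  rw [integral_finsetSum _ fun α _ => integrableOn_sq_cutArg_sub _ _]
  calc _ ≤ ∑ α, 2 * Real.pi * (10 * ‖(v (T.vertex α) : ℂ) - v (T.vertex (α + 1))‖) :=
        Finset.sum_le_sum fun α _ => integral_sq_cutArg_sub_le _ _
    _ ≤ ∑ α, 2 * Real.pi *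
          (10 * (1 / K ^ 2 + K ^ 2 * ‖(v (T.vertex α) : ℂ) - v (T.vertex (α + 1))‖ ^ 2)) := by
        gcongr
        exact le_inv_sq_add hK _
    _ = 2 * Real.pi * (30 / K ^ 2 + 10 * K ^ 2 * spread v T) := by
        simp only [spread, Fin.sum_univ_three]
        ring

/-- Averaging over the cut turns the squared angles, which may be large across the cut, into the
first powers of the chords. -/
lemma exists_sum_cutSpread_le (S : Finset Triangle) (v : Plane → Circle) {K : ℝ} (hK : 0 < K) :
    ∃ φ, ∑ T ∈ S, cutSpread φ v T ≤ ∑ T ∈ S, (30 / K ^ 2 + 10 * K ^ 2 * spread v T) := by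
  have hvol : volume.real (Set.Ioc (-Real.pi) Real.pi) = 2 * Real.pi := by
    rw [Real.volume_real_Ioc_of_le (by linarith [Real.pi_pos])]
    ring
  have hvol_ne : volume (Set.Ioc (-Real.pi) Real.pi) ≠ 0 := fun h => by
    rw [measureReal_def, h, ENNReal.toReal_zero] at hvol
    linarith [Real.pi_pos]
  obtain ⟨φ, -, hφ⟩ := exists_le_setAverage hvol_ne measure_Ioc_lt_top.ne
    (integrable_finsetSum S fun T _ => integrableOn_cutSpread v T)
  refine ⟨φ, hφ.trans ?_⟩
  rw [setAverage_eq, hvol, smul_eq_mul, inv_mul_le_iff₀ Real.two_pi_pos, Finset.mul_sum,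
    integral_finsetSum _ fun T _ => integrableOn_cutSpread v T]
  exact Finset.sum_le_sum fun T _ => integral_cutSpread_le v T hK

/-! ### Damping the phase of a field -/

/-- A cut-off function with values in `[0, 1]` that varies by at most `1 / K` along the edges of
the lattice. -/
structure IsCutoff (K : ℝ) (η : Plane → ℝ) : Prop where
  nonneg : ∀ p, 0 ≤ η p
  le_one : ∀ p, η p ≤ 1
  abs_sub_le : ∀ ⦃p q⦄, dist p q ≤ 1 → |η p - η q| ≤ 1 / K

/-- The phase of a field relative to the pure interface. -/
def phase (ν : Plane) (W : Plane → Circle) (p : Plane) : Circle := W p / interface ν p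

/-- The field whose phase, measured with the cut at `φ`, is damped by the factor `η`. -/
def damped (ν : Plane) (φ : ℝ) (η : Plane → ℝ) (W : Plane → Circle) (p : Plane) : Circle :=
  Circle.exp (η p * cutArg φ (phase ν W p)) * interface ν p

/-- The triangle meets the transition layer of the cut-off. -/
def Triangle.IsActive (η : Plane → ℝ) (T : Triangle) : Prop :=
  (∃ α, η (T.vertex α) ≠ 1) ∧ ∃ α, η (T.vertex α) ≠ 0

/-- The chirality of the field in the triangle has the wrong sign. -/
def Triangle.IsBad (ν : Plane) (W : Plane → Circle) (T : Triangle) : Prop :=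
  T.IsOneSided ν ∧ jump ν (T.vertex 0) * unitChirality W T < 0

open Classical in
/-- The price of damping the phase in a triangle of the transition layer. -/
def weight (ν : Plane) (K : ℝ) (W : Plane → Circle) (T : Triangle) : ℝ :=
  (if T.IsBad ν W then 9 else 0) + (600 / K ^ 2 + 100 * K ^ 2 * cost W T)

section Damped

variable {ν : Plane} {K φ : ℝ} {η : Plane → ℝ} {W : Plane → Circle} {T : Triangle}

lemma phase_mul_interface (ν : Plane) (W : Plane → Circle) (p : Plane) :
    phase ν W p * interface ν p = W p :=
  div_mul_cancel _ _

lemma damped_of_eq_one {p : Plane} (h : η p = 1) : damped ν φ η W p = W p := by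
  rw [damped, h, one_mul, exp_cutArg, phase_mul_interface]

lemma damped_of_eq_zero {p : Plane} (h : η p = 0) : damped ν φ η W p = interface ν p := by
  rw [damped, h, zero_mul, Circle.exp_zero, one_mul]

lemma weight_nonneg (ν : Plane) (K : ℝ) (W : Plane → Circle) (T : Triangle) :
    0 ≤ weight ν K W T := by
  have h := cost_nonneg W T
  rw [weight]
  split_ifs <;> positivity

lemma cutSpread_nonneg (φ : ℝ) (v : Plane → Circle) (T : Triangle) : 0 ≤ cutSpread φ v T :=
  Finset.sum_nonneg fun _ _ => sq_nonneg _

lemma spread_phase_le (hT : T.IsOneSided ν) (hgood : ¬T.IsBad ν W) :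
    spread (phase ν W) T ≤ 5 * cost W T :=
  spread_le_cost hT (fun _ => (phase_mul_interface ν W _).symm)
    (not_lt.1 fun h => hgood ⟨hT, h⟩)

lemma sq_norm_exp_mul_sub_le {x y a b : ℝ} (hx0 : 0 ≤ x) (hx1 : x ≤ 1) (hxy : |x - y| ≤ 1 / K)
    (hb : |b| ≤ 3 * Real.pi) :
    ‖(Circle.exp (x * a) : ℂ) - Circle.exp (y * b)‖ ^ 2 ≤ 2 * (a - b) ^ 2 + 180 / K ^ 2 := by
  have h1 : |x * (a - b)| ≤ |a - b| := by
    rw [abs_mul, abs_of_nonneg hx0]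
    exact mul_le_of_le_one_left (abs_nonneg _) hx1
  have h2 : |(x - y) * b| ≤ 1 / K * (3 * Real.pi) := by
    rw [abs_mul]
    exact mul_le_mul hxy hb (abs_nonneg _) ((abs_nonneg _).trans hxy)
  have hpi : (3 * Real.pi) ^ 2 ≤ 90 := by nlinarith [Real.pi_lt_d2, Real.pi_pos]
  calc ‖(Circle.exp (x * a) : ℂ) - Circle.exp (y * b)‖ ^ 2
      ≤ |x * a - y * b| ^ 2 := by
        gcongr
        exact norm_exp_sub_exp_le _ _
    _ = (x * (a - b) + (x - y) * b) ^ 2 := by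
        rw [sq_abs]
        ring
    _ ≤ 2 * (|x * (a - b)| ^ 2 + |(x - y) * b| ^ 2) := by
        simpa only [sq_abs] using add_sq_le
    _ ≤ 2 * (|a - b| ^ 2 + (1 / K * (3 * Real.pi)) ^ 2) := by gcongr
    _ = 2 * (a - b) ^ 2 + 2 * (1 / K) ^ 2 * (3 * Real.pi) ^ 2 := by
        rw [sq_abs]
        ring
    _ ≤ 2 * (a - b) ^ 2 + 2 * (1 / K) ^ 2 * 90 := by gcongr
    _ = 2 * (a - b) ^ 2 + 180 / K ^ 2 := by ring

lemma cost_damped_le (hη : IsCutoff K η) (φ : ℝ) (W : Plane → Circle) (hT : T.IsOneSided ν) :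
    cost (damped ν φ η W) T ≤ 2 * cutSpread φ (phase ν W) T + 540 / K ^ 2 := by
  calc cost (damped ν φ η W) T
      ≤ spread (fun p => Circle.exp (η p * cutArg φ (phase ν W p))) T :=
        cost_le_spread hT fun _ => rfl
    _ ≤ ∑ α, (2 * (cutArg φ (phase ν W (T.vertex α)) -
          cutArg φ (phase ν W (T.vertex (α + 1)))) ^ 2 + 180 / K ^ 2) :=
        Finset.sum_le_sum fun α _ => sq_norm_exp_mul_sub_le (hη.nonneg _) (hη.le_one _)
          (hη.abs_sub_le (T.dist_le _ _)) (abs_cutArg_le _ _)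
    _ = 2 * cutSpread φ (phase ν W) T + 540 / K ^ 2 := by
        simp only [cutSpread, Fin.sum_univ_three]
        ring

open Classical in
lemma cost_damped_le_add (hη : IsCutoff K η) (φ : ℝ) (W : Plane → Circle) (T : Triangle) :
    cost (damped ν φ η W) T ≤ cost W T +
      (if ¬T.IsOneSided ν ∧ ∃ α, η (T.vertex α) ≠ 1 then 9 else 0) +
      (if T.IsActive η then (if T.IsBad ν W then 9 else 0) +
        (if T.IsOneSided ν ∧ ¬T.IsBad ν W then
          2 * cutSpread φ (phase ν W) T + 540 / K ^ 2 else 0) else 0) := by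
  have hcost := cost_nonneg W T
  have hspread := cutSpread_nonneg φ (phase ν W) T
  have hle := cost_le (damped ν φ η W) T
  by_cases h1 : ∃ α, η (T.vertex α) ≠ 1
  swap
  · push Not at h1
    rw [cost_congr fun α => damped_of_eq_one (h1 α), add_assoc]
    exact le_add_of_nonneg_right (by split_ifs <;> positivity)
  by_cases hT : T.IsOneSided ν
  swap
  · rw [if_pos ⟨hT, h1⟩]
    refine le_add_of_le_of_nonneg (by linarith) (by split_ifs <;> positivity)
  by_cases h0 : ∃ α, η (T.vertex α) ≠ 0
  swap
  · push Not at h0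
    rw [cost_eq_zero hT fun α => damped_of_eq_zero (h0 α)]
    split_ifs <;> positivity
  have hactive : T.IsActive η := ⟨h1, h0⟩
  rw [if_neg fun h => h.1 hT, if_pos hactive]
  by_cases hbad : T.IsBad ν W
  · rw [if_pos hbad, if_neg fun h => h.2 hbad]
    linarith
  · rw [if_neg hbad, if_pos ⟨hT, hbad⟩]
    linarith [cost_damped_le hη φ W hT]

lemma exists_sum_cutSpread_phase_le (hK : 0 < K) (S : Finset Triangle)
    (hS : ∀ T ∈ S, T.IsOneSided ν ∧ ¬T.IsBad ν W) :
    ∃ φ, ∑ T ∈ S, (2 * cutSpread φ (phase ν W) T + 540 / K ^ 2) ≤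
      ∑ T ∈ S, (600 / K ^ 2 + 100 * K ^ 2 * cost W T) := by
  obtain ⟨φ, hφ⟩ := exists_sum_cutSpread_le S (phase ν W) hK
  refine ⟨φ, ?_⟩
  calc ∑ T ∈ S, (2 * cutSpread φ (phase ν W) T + 540 / K ^ 2)
      = 2 * ∑ T ∈ S, cutSpread φ (phase ν W) T + ∑ T ∈ S, 540 / K ^ 2 := by
        rw [Finset.sum_add_distrib, Finset.mul_sum]
    _ ≤ 2 * ∑ T ∈ S, (30 / K ^ 2 + 10 * K ^ 2 * spread (phase ν W) T) + ∑ T ∈ S, 540 / K ^ 2 := by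
        gcongr
    _ = ∑ T ∈ S, (600 / K ^ 2 + 20 * K ^ 2 * spread (phase ν W) T) := by
        rw [Finset.mul_sum, ← Finset.sum_add_distrib]
        exact Finset.sum_congr rfl fun T _ => by ring
    _ ≤ ∑ T ∈ S, (600 / K ^ 2 + 20 * K ^ 2 * (5 * cost W T)) := by
        gcongr with T hT
        exact spread_phase_le (hS T hT).1 (hS T hT).2
    _ = ∑ T ∈ S, (600 / K ^ 2 + 100 * K ^ 2 * cost W T) :=
        Finset.sum_congr rfl fun T _ => by ring

open Classical in
lemma exists_sum_cost_damped_le (hK : 0 < K) (hη : IsCutoff K η) (ν : Plane) (W : Plane → Circle)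
    (F : Finset Triangle) :
    ∃ φ, ∑ T ∈ F, cost (damped ν φ η W) T ≤ ∑ T ∈ F, cost W T +
      9 * (F.filter fun T => ¬T.IsOneSided ν ∧ ∃ α, η (T.vertex α) ≠ 1).card +
      ∑ T ∈ F with T.IsActive η, weight ν K W T := by
  let A := F.filter fun T => T.IsActive η
  let S := A.filter fun T => T.IsOneSided ν ∧ ¬T.IsBad ν W
  obtain ⟨φ, hφ⟩ := exists_sum_cutSpread_phase_le hK S fun T hT => (Finset.mem_filter.1 hT).2
  have hsub : ∑ T ∈ S, (600 / K ^ 2 + 100 * K ^ 2 * cost W T) ≤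
      ∑ T ∈ A, (600 / K ^ 2 + 100 * K ^ 2 * cost W T) :=
    Finset.sum_le_sum_of_subset_of_nonneg (Finset.filter_subset _ _) fun T _ _ => by
      have h := cost_nonneg W T
      positivity
  have hactive : ∑ T ∈ A, ((if T.IsBad ν W then 9 else 0) + (if T.IsOneSided ν ∧ ¬T.IsBad ν W then
      2 * cutSpread φ (phase ν W) T + 540 / K ^ 2 else 0)) ≤ ∑ T ∈ A, weight ν K W T := by
    simp only [weight]
    rw [Finset.sum_add_distrib, Finset.sum_add_distrib (s := A), ← Finset.sum_filter (s := A)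
      (p := fun T => T.IsOneSided ν ∧ ¬T.IsBad ν W)]
    exact add_le_add_right (hφ.trans hsub) _
  refine ⟨φ, (Finset.sum_le_sum fun T _ => cost_damped_le_add hη φ W T).trans ?_⟩
  rw [Finset.sum_add_distrib, Finset.sum_add_distrib, ← Finset.sum_filter, ← Finset.sum_filter,
    Finset.sum_const, nsmul_eq_mul, mul_comm _ (9 : ℝ)]
  exact add_le_add_right hactive _

end Damped

/-! ### The boundary layer -/

/-- The distance of a point of the square of half side `R` to its boundary; outside of the square
the value is not positive. -/
def depth (ν : Plane) (R : ℝ) (p : Plane) : ℝ := R - max |along ν p| |height ν p|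

/-- The cut-off that grows from `0` to `1` between the depths `4 + r K` and `4 + (r + 1) K`. -/
def cutoff (ν : Plane) (R K : ℝ) (r : ℕ) (p : Plane) : ℝ :=
  max 0 (min 1 ((depth ν R p - 4) / K - r))

/-- The triangle has a vertex of depth less than `D`. -/
def Triangle.InCollar (ν : Plane) (R D : ℝ) (T : Triangle) : Prop :=
  ∃ α, depth ν R (T.vertex α) < D

section Layer

variable {ν : Plane} {R K : ℝ} {r J : ℕ} {p : Plane} {T : Triangle}

lemma abs_depth_sub_le (hν : ‖ν‖ = 1) (R : ℝ) (p q : Plane) :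
    |depth ν R p - depth ν R q| ≤ dist p q := by
  rw [depth, depth, sub_sub_sub_cancel_left, abs_sub_comm]
  exact (abs_max_sub_max_le_max _ _ _ _).trans (max_le
    ((abs_abs_sub_abs_le _ _).trans (abs_along_sub_le hν p q))
    ((abs_abs_sub_abs_le _ _).trans (abs_height_sub_le hν p q)))

lemma isCutoff_cutoff (hν : ‖ν‖ = 1) (hK : 0 < K) : IsCutoff K (cutoff ν R K r) where
  nonneg _ := le_max_left _ _
  le_one _ := max_le zero_le_one (min_le_left _ _)
  abs_sub_le p q hpq := by
    have hconst (a : ℝ) : |a - a| ≤ 1 / K := by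
      rw [sub_self, abs_zero]
      positivity
    refine (abs_max_sub_max_le_max _ _ _ _).trans (max_le (hconst 0) ?_)
    refine (abs_min_sub_min_le_max _ _ _ _).trans (max_le (hconst 1) ?_)
    rw [sub_sub_sub_cancel_right, ← sub_div, sub_sub_sub_cancel_right, abs_div, abs_of_pos hK]
    gcongr
    exact (abs_depth_sub_le hν R p q).trans hpq

lemma depth_lt_of_cutoff_ne_one (hK : 0 < K) (h : cutoff ν R K r p ≠ 1) :
    depth ν R p < 4 + (r + 1) * K := by
  by_contra! hle
  have h1 : 1 ≤ (depth ν R p - 4) / K - r := by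
    rw [le_sub_iff_add_le, le_div_iff₀ hK]
    linarith
  exact h (by rw [cutoff, min_eq_left h1, max_eq_right zero_le_one])

lemma lt_depth_of_cutoff_ne_zero (hK : 0 < K) (h : cutoff ν R K r p ≠ 0) :
    4 + r * K < depth ν R p := by
  by_contra! hle
  have h0 : (depth ν R p - 4) / K - r ≤ 0 := by
    rw [sub_nonpos, div_le_iff₀ hK]
    linarith
  exact h (by rw [cutoff, max_eq_left ((min_le_right _ _).trans h0)])

lemma cutoff_eq_zero_of_notMem_box (hK : 0 < K) (hp : p ∉ box ν (R - 4)) :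
    cutoff ν R K r p = 0 := by
  by_contra h
  have hdepth := lt_depth_of_cutoff_ne_zero hK h
  have hr : 0 ≤ r * K := by positivity
  have hmax : max |along ν p| |height ν p| < R - 4 := by
    rw [depth] at hdepth
    linarith
  exact hp (max_lt_iff.1 hmax)

lemma inCollar_of_cutoff_ne_one (hK : 0 < K) (hr : r < J)
    (h : ∃ α, cutoff ν R K r (T.vertex α) ≠ 1) : T.InCollar ν R (4 + J * K) := by
  obtain ⟨α, hα⟩ := h
  refine ⟨α, (depth_lt_of_cutoff_ne_one hK hα).trans_le ?_⟩
  gcongr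
  exact_mod_cast hr

lemma Triangle.IsActive.depth_mem_Ioo (hν : ‖ν‖ = 1) (hK : 0 < K)
    (h : T.IsActive (cutoff ν R K r)) :
    depth ν R (T.vertex 0) ∈ Set.Ioo (3 + r * K) (5 + (r + 1) * K) := by
  obtain ⟨⟨α, hα⟩, β, hβ⟩ := h
  have hlt := depth_lt_of_cutoff_ne_one hK hα
  have hgt := lt_depth_of_cutoff_ne_zero hK hβ
  have hdistα := abs_le.1 ((abs_depth_sub_le hν R _ _).trans (T.dist_le α 0))
  have hdistβ := abs_le.1 ((abs_depth_sub_le hν R _ _).trans (T.dist_le β 0))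
  constructor <;> linarith

lemma card_le_two_of_forall_le_add_one {s : Finset ℕ} (h : ∀ m ∈ s, ∀ n ∈ s, n ≤ m + 1) :
    s.card ≤ 2 := by
  rcases s.eq_empty_or_nonempty with rfl | hs
  · simp
  have hsub : s ⊆ Finset.Icc (s.min' hs) (s.min' hs + 1) := fun n hn =>
    Finset.mem_Icc.2 ⟨s.min'_le n hn, h _ (s.min'_mem hs) n hn⟩
  calc s.card ≤ (Finset.Icc (s.min' hs) (s.min' hs + 1)).card := Finset.card_le_card hsub
    _ = 2 := by
        rw [Nat.card_Icc]
        lia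

open Classical in
lemma card_isActive_le (hν : ‖ν‖ = 1) (hK : 2 ≤ K) (s : Finset ℕ) :
    (s.filter fun r => T.IsActive (cutoff ν R K r)).card ≤ 2 := by
  have hK0 : 0 < K := by linarith
  refine card_le_two_of_forall_le_add_one fun m hm n hn => ?_
  obtain ⟨-, hlt⟩ := (Finset.mem_filter.1 hm).2.depth_mem_Ioo hν hK0
  obtain ⟨hgt, -⟩ := (Finset.mem_filter.1 hn).2.depth_mem_Ioo hν hK0
  have h : (n : ℝ) < m + 2 := by
    rw [← mul_lt_mul_iff_left₀ hK0]
    linarith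
  exact Nat.lt_succ_iff.1 (by exact_mod_cast h)

open Classical in
/-- A triangle meets at most two of the transition layers, so the lightest of `J` layers carries at
most the fraction `2 / J` of the collar. -/
lemma exists_sum_isActive_le (hν : ‖ν‖ = 1) (hK : 2 ≤ K) (hJ : J ≠ 0) (F : Finset Triangle)
    {w : Triangle → ℝ} (hw : ∀ T, 0 ≤ w T) :
    ∃ r < J, ∑ T ∈ F with T.IsActive (cutoff ν R K r), w T ≤
      2 / J * ∑ T ∈ F with T.InCollar ν R (4 + J * K), w T := by
  have hK0 : 0 < K := by linarith
  suffices h : ∑ r ∈ Finset.range J, ∑ T ∈ F with T.IsActive (cutoff ν R K r), w T ≤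
      ∑ r ∈ Finset.range J, 2 / J * ∑ T ∈ F with T.InCollar ν R (4 + J * K), w T by
    simpa only [Finset.mem_range] using
      Finset.exists_le_of_sum_le (Finset.nonempty_range_iff.2 hJ) h
  calc ∑ r ∈ Finset.range J, ∑ T ∈ F with T.IsActive (cutoff ν R K r), w T
      = ∑ T ∈ F with T.InCollar ν R (4 + J * K),
          ∑ r ∈ Finset.range J with T.IsActive (cutoff ν R K r), w T := by
        refine Finset.sum_comm' fun r T => ?_
        simp only [Finset.mem_filter, Finset.mem_range]
        exact ⟨fun ⟨hr, hT, h⟩ => ⟨⟨hr, h⟩, hT, inCollar_of_cutoff_ne_one hK0 hr h.1⟩,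
          fun ⟨⟨hr, h⟩, hT, _⟩ => ⟨hr, hT, h⟩⟩
    _ ≤ ∑ T ∈ F with T.InCollar ν R (4 + J * K), 2 * w T := by
        refine Finset.sum_le_sum fun T _ => ?_
        rw [Finset.sum_const, nsmul_eq_mul]
        exact mul_le_mul_of_nonneg_right (mod_cast card_isActive_le hν hK _) (hw T)
    _ = ∑ r ∈ Finset.range J, 2 / J * ∑ T ∈ F with T.InCollar ν R (4 + J * K), w T := by
        rw [Finset.sum_const, Finset.card_range, nsmul_eq_mul, ← Finset.mul_sum]
        field_simp

end Layer

/-! ### Counting triangles -/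

section Counting

variable {ν : Plane} {R D : ℝ}

open Classical in
lemma card_le_of_abs_along_mem_Icc (hν : ‖ν‖ = 1) (s : Finset Triangle) {a b c : ℝ} (hab : a ≤ b)
    (hc : 0 ≤ c)
    (h : ∀ T ∈ s, ∃ α, |along ν (T.vertex α)| ∈ Set.Icc a b ∧ |height ν (T.vertex α)| ≤ c) :
    (s.card : ℝ) ≤ 24 * ((b - a + 2) * (2 * c + 2)) := by
  let F (x y : ℝ) := s.filter fun T =>
    ∃ α, along ν (T.vertex α) ∈ Set.Icc x y ∧ height ν (T.vertex α) ∈ Set.Icc (-c) c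
  have hsub : s ⊆ F a b ∪ F (-b) (-a) := by
    intro T hT
    obtain ⟨α, ⟨ha, hb⟩, hα⟩ := h T hT
    have hb' := abs_le.1 hb
    rw [Finset.mem_union, Finset.mem_filter, Finset.mem_filter]
    exact (le_abs.1 ha).imp (fun ha => ⟨hT, α, ⟨ha, hb'.2⟩, abs_le.1 hα⟩)
      fun ha => ⟨hT, α, ⟨hb'.1, le_neg.1 ha⟩, abs_le.1 hα⟩
  have hF {x y : ℝ} (hxy : x ≤ y) : ((F x y).card : ℝ) ≤ 12 * ((y - x + 2) * (c - -c + 2)) :=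
    card_le_of_vertex_mem_rect hν _ hxy (by linarith) fun T hT => (Finset.mem_filter.1 hT).2
  calc (s.card : ℝ) ≤ (F a b).card + (F (-b) (-a)).card := by
        exact_mod_cast (Finset.card_le_card hsub).trans (Finset.card_union_le _ _)
    _ ≤ 12 * ((b - a + 2) * (c - -c + 2)) + 12 * ((-a - -b + 2) * (c - -c + 2)) := by
        gcongr
        exacts [hF hab, hF (neg_le_neg hab)]
    _ = 24 * ((b - a + 2) * (2 * c + 2)) := by ring

lemma card_le_of_abs_height_mem_Icc (hν : ‖ν‖ = 1) (s : Finset Triangle) {a b c : ℝ} (hab : a ≤ b)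
    (hc : 0 ≤ c)
    (h : ∀ T ∈ s, ∃ α, |height ν (T.vertex α)| ∈ Set.Icc a b ∧ |along ν (T.vertex α)| ≤ c) :
    (s.card : ℝ) ≤ 24 * ((b - a + 2) * (2 * c + 2)) := by
  have hheight (x : Plane) : height (perp ν) x = along ν x := rfl
  have halong (x : Plane) : |along (perp ν) x| = |height ν x| := by
    have hperp : perp (perp ν) = -ν := by
      ext i
      fin_cases i <;> simp [perp]
    rw [along, height, innerSL_apply_apply, innerSL_apply_apply, hperp, inner_neg_left, abs_neg]
  refine card_le_of_abs_along_mem_Icc ((norm_perp ν).trans hν) s hab hc ?_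
  simpa only [hheight, halong] using h

open Classical in
lemma card_inCollar_le (hν : ‖ν‖ = 1) (hR : 0 ≤ R) (hD : 0 ≤ D) :
    (((triF ν R).filter fun T => T.InCollar ν R D).card : ℝ) ≤ 48 * ((D + 2) * (2 * R + 2)) := by
  let A := (triF ν R).filter fun T =>
    ∃ α, |along ν (T.vertex α)| ∈ Set.Icc (R - D) R ∧ |height ν (T.vertex α)| ≤ R
  let H := (triF ν R).filter fun T =>
    ∃ α, |height ν (T.vertex α)| ∈ Set.Icc (R - D) R ∧ |along ν (T.vertex α)| ≤ R
  have hsub : ((triF ν R).filter fun T => T.InCollar ν R D) ⊆ A ∪ H := by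
    intro T hT
    obtain ⟨hTR, α, hα⟩ := Finset.mem_filter.1 hT
    obtain ⟨ha, hh⟩ := (mem_triF hν).1 hTR α
    rw [depth, sub_lt_comm, lt_max_iff] at hα
    rw [Finset.mem_union, Finset.mem_filter, Finset.mem_filter]
    exact hα.imp (fun h => ⟨hTR, α, ⟨h.le, ha.le⟩, hh.le⟩) fun h => ⟨hTR, α, ⟨h.le, hh.le⟩, ha.le⟩
  have hle : R - D ≤ R := sub_le_self R hD
  have hA : (A.card : ℝ) ≤ _ :=
    card_le_of_abs_along_mem_Icc hν A hle hR fun T hT => (Finset.mem_filter.1 hT).2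
  have hH : (H.card : ℝ) ≤ _ :=
    card_le_of_abs_height_mem_Icc hν H hle hR fun T hT => (Finset.mem_filter.1 hT).2
  calc _ ≤ (A.card : ℝ) + H.card := by
        exact_mod_cast (Finset.card_le_card hsub).trans (Finset.card_union_le _ _)
    _ ≤ _ := add_le_add hA hH
    _ = 48 * ((D + 2) * (2 * R + 2)) := by ring

lemma abs_height_le_one_of_not_isOneSided (hν : ‖ν‖ = 1) {T : Triangle} (hT : ¬T.IsOneSided ν)
    (α : Fin 3) : |height ν (T.vertex α)| ≤ 1 := by
  have hdist (β : Fin 3) :=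
    (abs_height_sub_le hν _ _).trans (T.dist_le β α)
  by_contra! hα
  have hside (β : Fin 3) : 0 ≤ height ν (T.vertex β) ↔ 0 ≤ height ν (T.vertex α) :=
    nonneg_iff_of_abs_sub_lt ((hdist β).trans_lt hα)
  exact hT fun β => jump_eq_jump_iff.2 ((hside β).trans (hside 0).symm)

open Classical in
lemma card_crossing_le (hν : ‖ν‖ = 1) (hD : 0 ≤ D) (hDR : D + 1 ≤ R) :
    (((triF ν R).filter fun T => ¬T.IsOneSided ν ∧ T.InCollar ν R D).card : ℝ) ≤
      96 * (D + 2) := by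
  calc _ ≤ 24 * ((R - (R - D) + 2) * (2 * 1 + 2)) := by
        refine card_le_of_abs_along_mem_Icc hν _ (sub_le_self R hD) zero_le_one fun T hT => ?_
        obtain ⟨hTR, hcross, α, hα⟩ := Finset.mem_filter.1 hT
        have hheight := abs_height_le_one_of_not_isOneSided hν hcross α
        rw [depth, sub_lt_comm, lt_max_iff, or_iff_left (by linarith)] at hα
        exact ⟨α, ⟨hα.le, ((mem_triF hν).1 hTR α).1.le⟩, hheight⟩
    _ = 96 * (D + 2) := by ring

end Counting

/-! ### Triangles of wrong chirality -/

section Bad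

variable {ν : Plane} {ε : ℝ} {T : Triangle} {x : Plane}

lemma chirality_eq_of_mem_interior (hε : 0 < ε) (u : SpinField ε) (hx : x ∈ interior (T.hull ε)) :
    chirality u x = unitChirality u.toUnit T := by
  have h : ∃ T : Triangle, x ∈ interior (T.hull ε) := ⟨T, hx⟩
  rw [chirality, dif_pos h, Triangle.eq_of_mem_interior hε h.choose_spec hx, triangleChirality_eq]

lemma Triangle.IsOneSided.jump_eq (hT : T.IsOneSided ν) (hε : 0 < ε) (hx : x ∈ T.hull ε) :
    jump ν x = jump ν (T.vertex 0) := by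
  have hside (α : Fin 3) := jump_eq_jump_iff.1 (hT α)
  rw [jump_eq_jump_iff]
  by_cases h0 : 0 ≤ height ν (T.vertex 0)
  · refine iff_of_true ?_ h0
    refine convexHull_min ?_ (convex_halfSpace_ge (height ν).toLinearMap.isLinear 0) hx
    rintro _ ⟨α, rfl⟩
    have h : 0 ≤ height ν (ε • T.vertex α) := by
      rw [map_smul]
      exact smul_nonneg hε.le ((hside α).2 h0)
    exact h
  · refine iff_of_false (not_le.2 ?_) h0
    refine convexHull_min ?_ (convex_halfSpace_lt (height ν).toLinearMap.isLinear 0) hx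
    rintro _ ⟨α, rfl⟩
    have h : height ν (ε • T.vertex α) < 0 := by
      rw [map_smul]
      exact mul_neg_of_pos_of_neg hε (not_le.1 fun h => h0 ((hside α).1 h))
    exact h

lemma one_le_enorm_of_isBad (hε : 0 < ε) (u : SpinField ε) (hT : T.IsBad ν u.toUnit)
    (hx : x ∈ interior (T.hull ε)) : 1 ≤ ‖chirality u x - jump ν x‖ₑ := by
  have habs : 1 ≤ |chirality u x - jump ν x| := by
    obtain ⟨hside, hbad⟩ := hT
    rw [chirality_eq_of_mem_interior hε u hx, hside.jump_eq hε (interior_subset hx), le_abs]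
    by_cases h0 : 0 ≤ height ν (T.vertex 0)
    · rw [jump_of_height_nonneg h0] at hbad ⊢
      right
      linarith
    · rw [jump_of_height_neg (not_le.1 h0)] at hbad ⊢
      left
      linarith
  rw [← ofReal_norm, Real.norm_eq_abs]
  exact ENNReal.one_le_ofReal.2 habs

open Classical in
lemma card_isBad_le (hν : ‖ν‖ = 1) (hε : 0 < ε) (u : SpinField ε) :
    ENNReal.ofReal
        (((triF ν (1 / 2 / ε)).filter fun T => T.IsBad ν u.toUnit).card * (ε ^ 2 / 12)) ≤
      eLpNorm (fun x => chirality u x - jump ν x) 1 (volume.restrict (square ν)) := by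
  let F := (triF ν (1 / 2 / ε)).filter fun T => T.IsBad ν u.toUnit
  let U := ⋃ T ∈ F, Metric.ball (T.center ε) (ε / 6)
  have hmeas : MeasurableSet U := F.measurableSet_biUnion fun T _ => measurableSet_ball
  have hsub : U ⊆ square ν := Set.iUnion₂_subset fun T hT => (T.ball_subset_hull hε).trans
    ((hull_subset_square_iff hε).2 ((mem_triF hν).1 (Finset.mem_filter.1 hT).1))
  rw [eLpNorm_one_eq_lintegral_enorm]
  calc ENNReal.ofReal (F.card * (ε ^ 2 / 12)) ≤ volume U :=
        card_mul_le_volume_of_ball_subset hε F fun T hT =>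
          Set.subset_biUnion_of_mem (u := fun T : Triangle => Metric.ball (T.center ε) (ε / 6)) hT
    _ = ∫⁻ _ in U, 1 := (setLIntegral_one U).symm
    _ ≤ ∫⁻ x in U, ‖chirality u x - jump ν x‖ₑ := by
        refine setLIntegral_mono' hmeas fun x hx => ?_
        obtain ⟨T, hT, hxT⟩ := Set.mem_iUnion₂.1 hx
        exact one_le_enorm_of_isBad hε u (Finset.mem_filter.1 hT).2
          (interior_maximal (T.ball_subset_hull hε) Metric.isOpen_ball hxT)
    _ ≤ ∫⁻ x in square ν, ‖chirality u x - jump ν x‖ₑ := lintegral_mono_set hsub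

end Bad

/-! ### The lower bound -/

/-- A bound for the energy created by damping the phase of a field of energy `E` in one of the first
`J` layers of width `K`, where `τ` is the `L¹` distance of its chirality from the pure jump. The
terms account for the triangles that cross the interface, those of wrong chirality, the gradient of
the cut-off and the cut of the angle, in this order. -/
def dampingError (ε K J E τ : ℝ) : ℝ :=
  6048 * (ε * J * K) + 216 * τ / (ε * J) + (806400 / K + 200 * K ^ 2 * E / J)

section LowerBound

variable {ν : Plane} {ε K E : ℝ}

open Classical in
lemma sum_weight_le (hν : ‖ν‖ = 1) {R D : ℝ} (hR : 0 ≤ R) (hD : 0 ≤ D) (K : ℝ)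
    (W : Plane → Circle) :
    ∑ T ∈ triF ν R with T.InCollar ν R D, weight ν K W T ≤
      9 * ((triF ν R).filter fun T => T.IsBad ν W).card +
        (600 / K ^ 2 * (48 * ((D + 2) * (2 * R + 2))) +
          100 * K ^ 2 * ∑ T ∈ triF ν R, cost W T) := by
  let C := (triF ν R).filter fun T => T.InCollar ν R D
  have hC : C ⊆ triF ν R := Finset.filter_subset _ _
  calc ∑ T ∈ C, weight ν K W T
      = 9 * (C.filter fun T => T.IsBad ν W).card +
          (600 / K ^ 2 * C.card + 100 * K ^ 2 * ∑ T ∈ C, cost W T) := by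
        simp only [weight]
        rw [Finset.sum_add_distrib, Finset.sum_add_distrib, ← Finset.sum_filter, Finset.sum_const,
          Finset.sum_const, nsmul_eq_mul, nsmul_eq_mul, ← Finset.mul_sum, mul_comm _ (9 : ℝ),
          mul_comm (C.card : ℝ)]
    _ ≤ _ := by
        gcongr
        · exact card_inCollar_le hν hR hD
        · exact fun T _ _ => cost_nonneg W T

lemma layer_error_le {J τ B C S : ℝ} (hε : 0 < ε) (hε' : ε ≤ 1 / 2) (hK : 2 ≤ K) (hJ : 1 ≤ J)
    (hB : B * (ε ^ 2 / 12) ≤ τ) (hS : ε * S ≤ E) (hC : C ≤ 96 * (4 + J * K + 2)) :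
    ε * (9 * C + 2 / J * (9 * B + (600 / K ^ 2 * (48 * ((4 + J * K + 2) * (2 * (1 / 2 / ε) + 2))) +
      100 * K ^ 2 * S))) ≤ dampingError ε K J E τ := by
  have hJK : 4 + J * K + 2 ≤ 7 * (J * K) := by nlinarith
  have hsum : ε * (2 * (1 / 2 / ε) + 2) = 1 + 2 * ε := by field_simp
  have hcross : ε * (9 * C) ≤ 6048 * (ε * J * K) :=
    calc ε * (9 * C) ≤ ε * (9 * (96 * (7 * (J * K)))) := by
          gcongr
          exact hC.trans (by gcongr)
      _ = 6048 * (ε * J * K) := by ring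
  have hbad : ε * (2 / J * (9 * B)) ≤ 216 * τ / (ε * J) :=
    calc ε * (2 / J * (9 * B)) = 216 * (B * (ε ^ 2 / 12)) / (ε * J) := by
          field_simp
          ring
      _ ≤ 216 * τ / (ε * J) := by gcongr
  have hgradient : ε * (2 / J * (600 / K ^ 2 *
      (48 * ((4 + J * K + 2) * (2 * (1 / 2 / ε) + 2))))) ≤ 806400 / K :=
    calc _ = 57600 / (J * K ^ 2) * ((4 + J * K + 2) * (ε * (2 * (1 / 2 / ε) + 2))) := by ring
      _ ≤ 57600 / (J * K ^ 2) * (7 * (J * K) * 2) := by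
          rw [hsum]
          gcongr
          linarith
      _ = 806400 / K := by
          field_simp
          norm_num
  have hcut : ε * (2 / J * (100 * K ^ 2 * S)) ≤ 200 * K ^ 2 * E / J :=
    calc ε * (2 / J * (100 * K ^ 2 * S)) = 200 * K ^ 2 * (ε * S) / J := by ring
      _ ≤ 200 * K ^ 2 * E / J := by gcongr
  rw [dampingError, mul_add, mul_add (2 / J), mul_add (2 / J), mul_add ε, mul_add ε, ← add_assoc]
  exact add_le_add (add_le_add hcross hbad) (add_le_add hgradient hcut)

open Classical in
/-- Modifying a field in a boundary layer, so that it attains the boundary data. -/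
lemma cellMin_le_ofReal_add_dampingError (hν : ‖ν‖ = 1) (hε : 0 < ε) (hε' : ε ≤ 1 / 2)
    (hK : 2 ≤ K) {J : ℕ} (hJ : J ≠ 0) (hJK : 4 + J * K + 1 ≤ 1 / 2 / ε) {u : SpinField ε}
    (hE : 0 ≤ E) (hu : energy u (square ν) ≤ ENNReal.ofReal E)
    (hχ : eLpNorm (fun x => chirality u x - jump ν x) 1 (volume.restrict (square ν)) ≠ ⊤) :
    cellMin ε ν ≤ ENNReal.ofReal (E + dampingError ε K J E
      (eLpNorm (fun x => chirality u x - jump ν x) 1 (volume.restrict (square ν))).toReal) := by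
  have hK0 : 0 < K := by linarith
  have hD : 0 ≤ 4 + J * K := by positivity
  let R := 1 / 2 / ε
  let F := triF ν R
  obtain ⟨r, hr, hlayer⟩ := exists_sum_isActive_le (R := R) hν hK hJ F
    (weight_nonneg ν K u.toUnit)
  obtain ⟨φ, hφ⟩ :=
    exists_sum_cost_damped_le hK0 (isCutoff_cutoff (R := R) (r := r) hν hK0) ν u.toUnit F
  have hS : ε * ∑ T ∈ F, cost u.toUnit T ≤ E := by
    rwa [energy_square_eq hν hε, ENNReal.ofReal_le_ofReal_iff hE] at hu
  have hB : ((F.filter fun T => T.IsBad ν u.toUnit).card : ℝ) * (ε ^ 2 / 12) ≤ _ :=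
    (ENNReal.ofReal_le_iff_le_toReal hχ).1 (card_isBad_le hν hε u)
  have hC : ((F.filter fun T => ¬T.IsOneSided ν ∧ ∃ α, cutoff ν R K r (T.vertex α) ≠ 1).card : ℝ) ≤
      96 * (4 + J * K + 2) := by
    refine le_trans ?_ (card_crossing_le hν hD hJK)
    gcongr with T
    exact inCollar_of_cutoff_ne_one hK0 hr
  refine (cellMin_le_ofReal (W := damped ν φ (cutoff ν R K r) u.toUnit) hν hε fun p hp _ =>
    damped_of_eq_zero (cutoff_eq_zero_of_notMem_box hK0 hp)).trans (ENNReal.ofReal_le_ofReal ?_)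
  have hweight := hlayer.trans (mul_le_mul_of_nonneg_left
    (sum_weight_le (R := R) hν (by positivity) hD K u.toUnit) (by positivity))
  have hsum := (hφ.trans (add_le_add_right hweight _)).trans_eq (add_assoc _ _ _)
  refine (mul_le_mul_of_nonneg_left hsum hε.le).trans ((mul_add _ _ _).trans_le (add_le_add hS ?_))
  exact layer_error_le hε hε' hK (Nat.one_le_cast.2 (Nat.one_le_iff_ne_zero.2 hJ)) hB hS hC

variable {ι : Type*} {l : Filter ι} {ε : ι → ℝ}

lemma tendsto_mul_natFloor (hε : Tendsto ε l (𝓝[>] 0)) {a : ℝ} (ha : 0 ≤ a) :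
    Tendsto (fun n => ε n * ⌊a * (ε n)⁻¹⌋₊) l (𝓝 a) := by
  refine ((tendsto_nat_floor_mul_div_atTop ha).comp (tendsto_inv_nhdsGT_zero.comp hε)).congr
    fun n => ?_
  rw [Function.comp_apply, Function.comp_apply, div_inv_eq_mul, mul_comm]

lemma tendsto_natFloor_mul_inv (hε : Tendsto ε l (𝓝[>] 0)) {a : ℝ} (ha : 0 < a) :
    Tendsto (fun n => ⌊a * (ε n)⁻¹⌋₊) l atTop := by
  have h : Tendsto (fun n => a * (ε n)⁻¹) l atTop :=
    (tendsto_inv_nhdsGT_zero.comp hε).const_mul_atTop ha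
  exact tendsto_nat_floor_atTop.comp h

lemma tendsto_dampingError (hε : Tendsto ε l (𝓝[>] 0)) {τ : ι → ℝ} (hτ : Tendsto τ l (𝓝 0))
    (hK : 0 < K) (E : ℝ) :
    Tendsto (fun n => dampingError (ε n) K ⌊1 / K ^ 2 * (ε n)⁻¹⌋₊ E (τ n)) l
      (𝓝 (812448 / K)) := by
  have ha : 0 < 1 / K ^ 2 := by positivity
  have hmul := tendsto_mul_natFloor hε ha.le
  have hinv := (tendsto_natCast_atTop_atTop (R := ℝ)).comp (tendsto_natFloor_mul_inv hε ha)
  have hlim : 812448 / K =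
      6048 * (1 / K ^ 2 * K) + 216 * 0 / (1 / K ^ 2) + (806400 / K + 0) := by
    field_simp
    norm_num
  rw [hlim]
  exact (((hmul.mul_const K).const_mul 6048).add ((hτ.const_mul 216).div hmul ha.ne')).add
    ((hinv.const_div_atTop _).const_add _)

lemma phi_le_ofReal_add (hν : ‖ν‖ = 1) {u : ∀ n, SpinField (ε n)} (hε : Tendsto ε l (𝓝[>] 0))
    (hχ : Tendsto (fun n => eLpNorm (fun x => chirality (u n) x - jump ν x) 1
      (volume.restrict (square ν))) l (𝓝 0)) (hE : 0 ≤ E)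
    (hu : ∃ᶠ n in l, energy (u n) (square ν) ≤ ENNReal.ofReal E) (hK : 2 < K) :
    phi ν ≤ ENNReal.ofReal (E + 812448 / K) := by
  have hK0 : 0 < K := by linarith
  have ha : 0 < 1 / K ^ 2 := by positivity
  have hpos : ∀ᶠ n in l, 0 < ε n := hε self_mem_nhdsWithin
  have hε0 : Tendsto ε l (𝓝 0) := hε.mono_right nhdsWithin_le_nhds
  have herror := tendsto_dampingError hε
    ((ENNReal.tendsto_toReal ENNReal.zero_ne_top).comp hχ) hK0 E
  have hlayers : ∀ᶠ n in l, 4 + ⌊1 / K ^ 2 * (ε n)⁻¹⌋₊ * K + 1 ≤ 1 / 2 / ε n := by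
    have h := (hε0.mul_const 5).add ((tendsto_mul_natFloor hε ha.le).mul_const K)
    have hlt : 0 * 5 + 1 / K ^ 2 * K < 1 / 2 := by
      field_simp
      linarith
    filter_upwards [h.eventually_lt_const hlt, hpos] with n hn hn_pos
    rw [le_div_iff₀ hn_pos]
    linarith
  have hbound : ∃ᶠ n in l, cellMin (ε n) ν ≤ ENNReal.ofReal (E + dampingError (ε n) K
      ⌊1 / K ^ 2 * (ε n)⁻¹⌋₊ E (eLpNorm (fun x => chirality (u n) x - jump ν x) 1
        (volume.restrict (square ν))).toReal) := by
    refine (hu.and_eventually <| hpos.and <|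
      (hε0.eventually_le_const one_half_pos).and <|
      ((tendsto_natFloor_mul_inv hε ha).eventually_ne_atTop 0).and <|
      hlayers.and (hχ.eventually_lt_const ENNReal.zero_lt_top)).mono ?_
    rintro n ⟨hn, hn_pos, hle, hJ, hJK, hfin⟩
    exact cellMin_le_ofReal_add_dampingError hν hn_pos hle hK.le hJ hJK hE hn hfin.ne
  exact le_of_tendsto_of_tendsto_of_frequently ((tendsto_cellMin hν).comp hε)
    (ENNReal.tendsto_ofReal (herror.const_add E)) hbound

lemma phi_le_liminf (hν : ‖ν‖ = 1) {u : ∀ n, SpinField (ε n)} (hε : Tendsto ε l (𝓝[>] 0))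
    (hχ : Tendsto (fun n => eLpNorm (fun x => chirality (u n) x - jump ν x) 1
      (volume.restrict (square ν))) l (𝓝 0)) :
    phi ν ≤ liminf (fun n => energy (u n) (square ν)) l := by
  refine le_of_forall_gt_imp_ge_of_dense fun b hb => ?_
  rcases eq_or_ne b ⊤ with rfl | hb_top
  · exact le_top
  have hfreq : ∃ᶠ n in l, energy (u n) (square ν) ≤ ENNReal.ofReal b.toReal := by
    rw [ENNReal.ofReal_toReal hb_top]
    exact (frequently_lt_of_liminf_lt (by isBoundedDefault) hb).mono fun n hn => hn.le
  have hlim : Tendsto (fun K : ℝ => ENNReal.ofReal (b.toReal + 812448 / K)) atTop (𝓝 b) := by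
    have h := ENNReal.tendsto_ofReal
      ((tendsto_const_nhds.div_atTop (a := 812448) tendsto_id).const_add b.toReal)
    rwa [add_zero, ENNReal.ofReal_toReal hb_top] at h
  exact ge_of_tendsto hlim ((eventually_gt_atTop 2).mono fun K hK =>
    phi_le_ofReal_add hν hε hχ ENNReal.toReal_nonneg hfreq hK)

end LowerBound

end AFXY

end

theorem proposition4p2 (ν : AFXY.Plane) (hν : ‖ν‖ = 1) :
    (Tendsto (fun ε => AFXY.cellMin ε ν) (𝓝[>] (0 : ℝ)) (𝓝 (AFXY.phi ν)) ∧ AFXY.phi ν < ⊤) ∧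
      AFXY.phi ν ≤ AFXY.psi 1 1 ν := by
  refine ⟨⟨AFXY.tendsto_cellMin hν, AFXY.phi_lt_top hν⟩, ?_⟩
  rw [AFXY.psi, ENNReal.ofReal_one, inv_one, one_mul]
  refine le_sInf ?_
  rintro E ⟨ε, u, hpos, hlim, hχ, rfl⟩
  exact AFXY.phi_le_liminf hν (tendsto_nhdsWithin_iff.2 ⟨hlim, Eventually.of_forall hpos⟩) hχ
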